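/- **Theorem (Hironaka's local flattener).** Let $\mathbb K=\mathbb R$ or $\mathbb C$. A *local analytic $\mathbb K$-algebra* is a nonzero quotient of a ring $\mathbb K\{x_1,\dots,x_n\}$ of convergent power series; these are the local rings $\mathcal O_X$ of germs $X$ of analytic spaces over $\mathbb K$, and a morphism of germs $X\to Y$ is the same thing as a homomorphism of $\mathbb K$-algebras $\mathcal O_Y\to\mathcal O_X$. Let $\varphi:Z\to W$ be a morphism of analytic space-germs, where $W$ is regular (i.e. $\mathcal O_W$ is a regular local ring), and let $F$ be a finite $\mathcal O_Z$-module. For a morphism of germs $\lambda:T\to W$ put $$F\,\tilde\otimes_{\mathcal O_W}\mathcal O_T:=F\otimes_{\mathcal O_Z}\bigl(\mathcal O_Z\,\tilde\otimes_{\mathcal O_W}\mathcal O_T\bigr),$$ where $\mathcal O_Z\,\tilde\otimes_{\mathcal O_W}\mathcal O_T$ is the analytic tensor product, i.e. the tensor product (coproduct) in the category of local analytic $\mathcal O_W$-algebras. Then there exists a unique analytic subgerm $P$ of $W$ (i.e. a unique local analytic $\mathbb K$-algebra $\mathcal O_P=\mathcal O_W/I$ which is a quotient of $\mathcal O_W$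 by an ideal $I$) such that: 1. $F\,\tilde\otimes_{\mathcal O_W}\mathcal O_P$ is a flat $\mathcal O_P$-module. 2. Let $\lambda_P:P\to W$ denote the embedding. For every morphism $\lambda:T\to W$ of germs of analytic spaces such that $F\,\tilde\otimes_{\mathcal O_W}\mathcal O_T$ is $\mathcal O_T$-flat, there exists a unique morphism $\mu:T\to P$ such that $\lambda=\lambda_P\circ\mu$. -/

import Mathlib

open scoped TensorProduct

universe u v

namespace AnalyticGerm

/-- `f ∈ 𝕜[[x₁,…,xₙ]]` is convergent if `∑ |f_α| r^|α| < ∞` for some `r > 0`, i.e. if it converges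
absolutely on some polydisc centred at the origin. -/
def IsConvergent {𝕜 : Type u} [RCLike 𝕜] {n : ℕ} (f : MvPowerSeries (Fin n) 𝕜) : Prop :=
  ∃ r : ℝ, 0 < r ∧
    Summable fun α : Fin n →₀ ℕ => ‖MvPowerSeries.coeff α f‖ * r ^ (Finsupp.degree α)

theorem IsConvergent.mono_radius {𝕜 : Type u} [RCLike 𝕜] {n : ℕ} {f : MvPowerSeries (Fin n) 𝕜}
    {r s : ℝ} (hs : 0 ≤ s) (hsr : s ≤ r)
    (h : Summable fun α : Fin n →₀ ℕ => ‖MvPowerSeries.coeff α f‖ * r ^ (Finsupp.degree α)) :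
    Summable fun α : Fin n →₀ ℕ => ‖MvPowerSeries.coeff α f‖ * s ^ (Finsupp.degree α) :=
  Summable.of_nonneg_of_le (fun α => by positivity) (fun α => by gcongr) h

theorem IsConvergent.add {𝕜 : Type u} [RCLike 𝕜] {n : ℕ} {f g : MvPowerSeries (Fin n) 𝕜}
    (hf : IsConvergent f) (hg : IsConvergent g) : IsConvergent (f + g) := by
  obtain ⟨r, hr, hf⟩ := hf
  obtain ⟨s, hs, hg⟩ := hg
  have ht : 0 < min r s := lt_min hr hs
  refine ⟨min r s, ht, ?_⟩
  refine Summable.of_nonneg_of_le (fun α => by positivity) (fun α => ?_)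
    ((IsConvergent.mono_radius ht.le (min_le_left r s) hf).add
      (IsConvergent.mono_radius ht.le (min_le_right r s) hg))
  rw [map_add, ← add_mul]
  gcongr
  exact norm_add_le _ _

theorem IsConvergent.mul {𝕜 : Type u} [RCLike 𝕜] {n : ℕ} {f g : MvPowerSeries (Fin n) 𝕜}
    (hf : IsConvergent f) (hg : IsConvergent g) : IsConvergent (f * g) := by
  classical
  obtain ⟨r, hr, hf⟩ := hf
  obtain ⟨s, hs, hg⟩ := hg
  have ht : 0 < min r s := lt_min hr hs
  refine ⟨min r s, ht, ?_⟩
  have hf' := IsConvergent.mono_radius ht.le (min_le_left r s) hf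
  have hg' := IsConvergent.mono_radius ht.le (min_le_right r s) hg
  have hprod := hf'.mul_of_nonneg hg' (fun α => by positivity) (fun α => by positivity)
  have key := summable_sum_mul_antidiagonal_of_summable_mul
    (f := fun α : Fin n →₀ ℕ => ‖MvPowerSeries.coeff α f‖ * min r s ^ Finsupp.degree α)
    (g := fun α : Fin n →₀ ℕ => ‖MvPowerSeries.coeff α g‖ * min r s ^ Finsupp.degree α) hprod
  refine Summable.of_nonneg_of_le (fun α => by positivity) (fun α => ?_) key
  rw [MvPowerSeries.coeff_mul]
  refine (mul_le_mul_of_nonneg_right (norm_sum_le _ _) (by positivity)).trans ?_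
  rw [Finset.sum_mul]
  refine Finset.sum_le_sum fun p hp => ?_
  rw [Finset.HasAntidiagonal.mem_antidiagonal] at hp
  rw [← hp, map_add, pow_add, norm_mul]
  exact le_of_eq (by ring)

theorem isConvergent_algebraMap {𝕜 : Type u} [RCLike 𝕜] {n : ℕ} (c : 𝕜) :
    IsConvergent (algebraMap 𝕜 (MvPowerSeries (Fin n) 𝕜) c) := by
  classical
  refine ⟨1, one_pos, summable_of_ne_finset_zero (s := {0}) fun α hα => ?_⟩
  rw [Finset.mem_singleton] at hα
  simp [MvPowerSeries.algebraMap_apply, MvPowerSeries.coeff_C, hα]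

/-- The algebra `𝕜{x₁,…,xₙ}` of convergent power series. -/
def ConvSeries (𝕜 : Type u) [RCLike 𝕜] (n : ℕ) : Subalgebra 𝕜 (MvPowerSeries (Fin n) 𝕜) where
  carrier := {f | IsConvergent f}
  mul_mem' := IsConvergent.mul
  add_mem' := IsConvergent.add
  algebraMap_mem' := isConvergent_algebraMap

/-- A local analytic `𝕜`-algebra: a nonzero quotient of some `𝕜{x₁,…,xₙ}`. These are the local
rings `𝒪_X` of germs `X` of analytic spaces over `𝕜`. A morphism of germs `X → Y` is the same
thing as a homomorphism of `𝕜`-algebras `𝒪_Y →ₐ[𝕜] 𝒪_X` (every such homomorphism is local). -/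
structure IsLocalAnalyticAlgebra (𝕜 : Type u) [RCLike 𝕜] (B : Type u) [CommRing B]
    [Algebra 𝕜 B] : Prop where
  nontrivial : Nontrivial B
  exists_surjective : ∃ (n : ℕ) (π : ConvSeries 𝕜 n →ₐ[𝕜] B), Function.Surjective π

/-- `D`, together with `ιZ : OZ → D` and `ιT : OT → D`, is the analytic tensor product of
`OZ` and `OT` over `OW` with respect to `φ : OW → OZ` and `lam : OW → OT`: the tensor
product (coproduct) of the two `OW`-algebras in the category of local analytic `OW`-algebras. -/
structure IsAnalyticTensorProduct {𝕜 : Type u} [RCLike 𝕜] {OW OZ OT D : Type u}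
    [CommRing OW] [Algebra 𝕜 OW] [CommRing OZ] [Algebra 𝕜 OZ] [CommRing OT] [Algebra 𝕜 OT]
    [CommRing D] [Algebra 𝕜 D] (φ : OW →ₐ[𝕜] OZ) (lam : OW →ₐ[𝕜] OT)
    (ιZ : OZ →ₐ[𝕜] D) (ιT : OT →ₐ[𝕜] D) : Prop where
  analytic : IsLocalAnalyticAlgebra 𝕜 D
  comm : ιZ.comp φ = ιT.comp lam
  existsUnique_lift : ∀ (E : Type u) [CommRing E] [Algebra 𝕜 E], IsLocalAnalyticAlgebra 𝕜 E →
    ∀ (f : OZ →ₐ[𝕜] E) (g : OT →ₐ[𝕜] E), f.comp φ = g.comp lam →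
      ∃! h : D →ₐ[𝕜] E, h.comp ιZ = f ∧ h.comp ιT = g

/-- The extension of scalars `D ⊗_{OZ} F` of the `OZ`-module `F` along `ιZ : OZ → D`. When `D` is
the analytic tensor product of `OZ` and `OT` over `OW`, this is the module `F ⊗̃_{OW} OT`. -/
abbrev ExtendedModule {𝕜 : Type u} [RCLike 𝕜] {OZ D : Type u} [CommRing OZ] [Algebra 𝕜 OZ]
    [CommRing D] [Algebra 𝕜 D] (ιZ : OZ →ₐ[𝕜] D) (F : Type v) [AddCommGroup F] [Module OZ F] :
    Type (max u v) :=
  letI : Algebra OZ D := ιZ.toRingHom.toAlgebra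
  D ⊗[OZ] F

/-- `D ⊗_{OZ} F` is flat over `OT`, where `OT` acts through `ιT : OT → D`. -/
def ExtendedModuleFlat {𝕜 : Type u} [RCLike 𝕜] {OZ OT D : Type u} [CommRing OZ] [Algebra 𝕜 OZ]
    [CommRing OT] [Algebra 𝕜 OT] [CommRing D] [Algebra 𝕜 D] (ιZ : OZ →ₐ[𝕜] D) (ιT : OT →ₐ[𝕜] D)
    (F : Type v) [AddCommGroup F] [Module OZ F] : Prop :=
  letI : Algebra OZ D := ιZ.toRingHom.toAlgebra
  letI : Module OT (ExtendedModule ιZ F) := Module.compHom (D ⊗[OZ] F) ιT.toRingHom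
  Module.Flat OT (ExtendedModule ιZ F)

/-- `F ⊗̃_{OW} OT` is `OT`-flat. The analytic tensor product `D` exists and is unique up to a unique
isomorphism, so it does not matter which model of it is used. -/
def FlatAfterBaseChange {𝕜 : Type u} [RCLike 𝕜] {OW OZ OT : Type u}
    [CommRing OW] [Algebra 𝕜 OW] [CommRing OZ] [Algebra 𝕜 OZ] [CommRing OT] [Algebra 𝕜 OT]
    (φ : OW →ₐ[𝕜] OZ) (F : Type v) [AddCommGroup F] [Module OZ F]
    (lam : OW →ₐ[𝕜] OT) : Prop :=
  ∃ (D : Type u) (_ : CommRing D) (_ : Algebra 𝕜 D) (ιZ : OZ →ₐ[𝕜] D) (ιT : OT →ₐ[𝕜] D),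
    IsAnalyticTensorProduct φ lam ιZ ιT ∧ ExtendedModuleFlat ιZ ιT F

end AnalyticGerm

/-! Present `Z → W` as a closed embedding into a product followed by the projection. Then `F = E /
N`, where `E` is a finite free module over the convergent series in variables `(s, t)` and `s` are
coordinates on a smooth germ containing `W`. Order the monomials of `E` and look at the leading
monomials of elements of `N` in the closed fibre `s = 0`. Hironaka division gives `N + L = E`, where
`L` consists of the vectors with no monomial divisible by a leading one (`exists_finset_division`).
Leading monomials involve only `t`, so membership in `L` is the vanishing of certain
`t`-coefficients, and `L` is a module over the series in `s`. A `𝕜`-basis `v` of the vectors of `L`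
not involving `s` maps to a basis of `F / 𝔪F`.

Thus `F = L / (N ∩ L)`, and the flattening ideal `I` is generated by all `t`-coefficients of
elements of `N ∩ L` (`exists_flattening_data`). Elements of `L` are in general not finite
combinations of `v`, so all statements about `v` are made modulo powers of `𝔪`.

Flatness over `𝒪_W / I`: if `I ≤ J`, a combination of `v` lying in `JF` has all its coefficients in
`J`. So modulo `I` the family `v` becomes a basis modulo every power of the maximal ideal, and this
forces flatness by the Artin–Rees lemma and Krull's intersection theorem
(`flat_of_forall_basis_mod_pow`).

Universality: if the base change to `T` is flat, the images of `v`, being independent in the closed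
fibre, are independent modulo every `𝔪_T ^ n` (`coeff_mem_of_linearCombination_mem`). Up to `𝔪 ^ n`,
the ideal `I` is generated by coefficients of relations between the `v` modulo `𝔪 ^ n`, and these
relations persist after base change. Hence the map to `𝒪_T` sends `I` into `⋂ 𝔪_T ^ n = 0`, so it
factors through `𝒪_W / I`. Uniqueness of `I` is formal.

Convergence in the division is handled by weighted `ℓ¹`-norms. Distinct primes `p` are attached to
the variables and components, and monomials are ordered by the resulting natural number. At radii `p
^ (-t)` a monomial of code `m` has weight `m ^ (-t)`, so the smallest code dominates for large `t`;
monomials involving `s` are then suppressed by shrinking the radii of `s` alone. -/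

namespace AnalyticGerm

open scoped ENNReal NNReal
open MvPowerSeries

/-! ### Weighted norms and the algebra of convergent series. -/

section Norms

variable {𝕜 : Type*} [RCLike 𝕜] {σ κ : Type*}

/-- The value `∏ r_i ^ a_i` of the monomial with exponent `a` at the polyradius `r`. -/
noncomputable def monWeight (r : σ → ℝ≥0) (a : σ →₀ ℕ) : ℝ≥0∞ :=
  a.prod fun i k => (r i : ℝ≥0∞) ^ k

theorem monWeight_zero (r : σ → ℝ≥0) : monWeight r 0 = 1 := by simp [monWeight]

theorem monWeight_add (r : σ → ℝ≥0) (a b : σ →₀ ℕ) :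
    monWeight r (a + b) = monWeight r a * monWeight r b := by
  classical
  exact Finsupp.prod_add_index' (fun _ => pow_zero _) fun _ _ _ => pow_add _ _ _

theorem monWeight_ne_top (r : σ → ℝ≥0) (a : σ →₀ ℕ) : monWeight r a ≠ ∞ := by
  unfold monWeight Finsupp.prod
  exact ENNReal.prod_ne_top fun i _ => ENNReal.pow_ne_top ENNReal.coe_ne_top

theorem monWeight_ne_zero {r : σ → ℝ≥0} (hr : ∀ i, 0 < r i) (a : σ →₀ ℕ) : monWeight r a ≠ 0 := by
  unfold monWeight Finsupp.prod
  exact Finset.prod_ne_zero_iff.2 fun i _ => pow_ne_zero _ (by simpa using (hr i).ne')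

theorem monWeight_mono {r s : σ → ℝ≥0} (h : r ≤ s) (a : σ →₀ ℕ) :
    monWeight r a ≤ monWeight s a := by
  unfold monWeight Finsupp.prod
  exact Finset.prod_le_prod' fun i _ => pow_le_pow_left' (by exact_mod_cast h i) _

theorem monWeight_const (r : ℝ≥0) (a : σ →₀ ℕ) :
    monWeight (fun _ => r) a = (r : ℝ≥0∞) ^ Finsupp.degree a := by
  unfold monWeight Finsupp.prod
  rw [Finset.prod_pow_eq_pow_sum, Finsupp.degree_apply]

theorem monWeight_single (r : σ → ℝ≥0) (i : σ) : monWeight r (Finsupp.single i 1) = r i := by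
  simp [monWeight]

/-- The weighted `ℓ¹`-norm `∑ |f_a| r^a` of a power series. -/
noncomputable def wnorm (r : σ → ℝ≥0) (f : MvPowerSeries σ 𝕜) : ℝ≥0∞ :=
  ∑' a, ‖coeff a f‖ₑ * monWeight r a

theorem wnorm_add_le (r : σ → ℝ≥0) (f g : MvPowerSeries σ 𝕜) :
    wnorm r (f + g) ≤ wnorm r f + wnorm r g := by
  unfold wnorm
  rw [← ENNReal.tsum_add]
  refine ENNReal.tsum_le_tsum fun a => ?_
  rw [← add_mul, map_add]
  gcongr
  exact enorm_add_le _ _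

theorem wnorm_mul_le (r : σ → ℝ≥0) (f g : MvPowerSeries σ 𝕜) :
    wnorm r (f * g) ≤ wnorm r f * wnorm r g := by
  classical
  have h : wnorm r f * wnorm r g = ∑' a : σ →₀ ℕ, ∑ p ∈ Finset.HasAntidiagonal.antidiagonal a,
      ‖coeff p.1 f‖ₑ * monWeight r p.1 * (‖coeff p.2 g‖ₑ * monWeight r p.2) := by
    unfold wnorm
    rw [← ENNReal.tsum_mul_right]
    simp_rw [← ENNReal.tsum_mul_left]
    rw [← ENNReal.tsum_prod' (f := fun p : (σ →₀ ℕ) × (σ →₀ ℕ) =>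
      ‖coeff p.1 f‖ₑ * monWeight r p.1 * (‖coeff p.2 g‖ₑ * monWeight r p.2)),
      ← Finset.HasAntidiagonal.sigmaAntidiagonalEquivProd.tsum_eq, ENNReal.tsum_sigma']
    refine tsum_congr fun a => ?_
    rw [tsum_fintype]
    exact Finset.sum_coe_sort (Finset.HasAntidiagonal.antidiagonal a) fun p =>
      ‖coeff p.1 f‖ₑ * monWeight r p.1 * (‖coeff p.2 g‖ₑ * monWeight r p.2)
  rw [h]
  refine ENNReal.tsum_le_tsum fun a => ?_
  rw [coeff_mul]
  refine (mul_le_mul_left (enorm_sum_le _ _) _).trans ?_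
  rw [Finset.sum_mul]
  refine Finset.sum_le_sum fun p hp => le_of_eq ?_
  rw [Finset.HasAntidiagonal.mem_antidiagonal] at hp
  rw [← hp, monWeight_add, enorm_mul]
  ring

theorem wnorm_mono {r s : σ → ℝ≥0} (h : r ≤ s) (f : MvPowerSeries σ 𝕜) :
    wnorm r f ≤ wnorm s f :=
  ENNReal.tsum_le_tsum fun a => by gcongr; exact monWeight_mono h a

theorem wnorm_monomial (r : σ → ℝ≥0) (a : σ →₀ ℕ) (c : 𝕜) :
    wnorm r (monomial a c) = ‖c‖ₑ * monWeight r a := by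
  classical
  unfold wnorm
  rw [tsum_eq_single a fun b hb => by rw [coeff_monomial_ne hb]; simp, coeff_monomial_same]

theorem wnorm_one (r : σ → ℝ≥0) : wnorm r (1 : MvPowerSeries σ 𝕜) = 1 := by
  have := wnorm_monomial (𝕜 := 𝕜) r 0 1
  rwa [monWeight_zero, enorm_one, one_mul] at this

theorem wnorm_pow_le (r : σ → ℝ≥0) (f : MvPowerSeries σ 𝕜) (n : ℕ) :
    wnorm r (f ^ n) ≤ wnorm r f ^ n := by
  induction n with
  | zero => simp [wnorm_one]
  | succ n ih =>
    rw [pow_succ, pow_succ]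
    exact (wnorm_mul_le _ _ _).trans (mul_le_mul_left ih _)

theorem wnorm_prod_le {ι : Type*} (r : σ → ℝ≥0) (s : Finset ι) (f : ι → MvPowerSeries σ 𝕜) :
    wnorm r (∏ i ∈ s, f i) ≤ ∏ i ∈ s, wnorm r (f i) := by
  classical
  induction s using Finset.induction with
  | empty => simp [wnorm_one]
  | insert i s hi ih =>
    rw [Finset.prod_insert hi, Finset.prod_insert hi]
    exact (wnorm_mul_le _ _ _).trans (mul_le_mul_right ih _)

/-- A power series whose norm is finite for some polyradius. -/
def HasPolyradius (f : MvPowerSeries σ 𝕜) : Prop :=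
  ∃ r : σ → ℝ≥0, (∀ i, 0 < r i) ∧ wnorm r f ≠ ∞

theorem HasPolyradius.add {f g : MvPowerSeries σ 𝕜} (hf : HasPolyradius f)
    (hg : HasPolyradius g) : HasPolyradius (f + g) := by
  obtain ⟨r, hr, hf⟩ := hf
  obtain ⟨s, hs, hg⟩ := hg
  refine ⟨r ⊓ s, fun i => lt_min (hr i) (hs i), ?_⟩
  refine ne_top_of_le_ne_top (ENNReal.add_ne_top.2 ⟨hf, hg⟩) ((wnorm_add_le _ _ _).trans ?_)
  exact add_le_add (wnorm_mono inf_le_left _) (wnorm_mono inf_le_right _)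

theorem HasPolyradius.mul {f g : MvPowerSeries σ 𝕜} (hf : HasPolyradius f)
    (hg : HasPolyradius g) : HasPolyradius (f * g) := by
  obtain ⟨r, hr, hf⟩ := hf
  obtain ⟨s, hs, hg⟩ := hg
  refine ⟨r ⊓ s, fun i => lt_min (hr i) (hs i), ?_⟩
  refine ne_top_of_le_ne_top (ENNReal.mul_ne_top hf hg) ((wnorm_mul_le _ _ _).trans ?_)
  exact mul_le_mul' (wnorm_mono inf_le_left _) (wnorm_mono inf_le_right _)

theorem hasPolyradius_monomial (a : σ →₀ ℕ) (c : 𝕜) : HasPolyradius (monomial a c) :=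
  ⟨fun _ => 1, fun _ => one_pos, by
    rw [wnorm_monomial]; exact ENNReal.mul_ne_top enorm_ne_top (monWeight_ne_top _ _)⟩

variable (𝕜 σ) in
/-- The algebra of convergent power series in the variables `σ`. -/
noncomputable def CS : Subalgebra 𝕜 (MvPowerSeries σ 𝕜) where
  carrier := {f | HasPolyradius f}
  mul_mem' := HasPolyradius.mul
  add_mem' := HasPolyradius.add
  algebraMap_mem' c := hasPolyradius_monomial 0 c

end Norms

theorem summable_norm_iff_tsum_enorm {𝕜 : Type*} [RCLike 𝕜] {n : ℕ} (f : MvPowerSeries (Fin n) 𝕜)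
    (r : ℝ≥0) : (Summable fun α : Fin n →₀ ℕ => ‖coeff α f‖ * (r : ℝ) ^ (Finsupp.degree α)) ↔
      wnorm (fun _ => r) f ≠ ∞ := by
  have h : wnorm (fun _ => r) f =
      ∑' a, ((‖coeff a f‖₊ * r ^ Finsupp.degree a : ℝ≥0) : ℝ≥0∞) := by
    unfold wnorm
    refine tsum_congr fun a => ?_
    rw [monWeight_const, enorm_eq_nnnorm]
    push_cast
    rfl
  rw [h, ENNReal.tsum_coe_ne_top_iff_summable, ← NNReal.summable_coe]
  simp

/-- With finitely many variables a polyradius may be replaced by the minimum of its entries. -/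
theorem convSeries_eq (𝕜 : Type u) [RCLike 𝕜] (n : ℕ) : ConvSeries 𝕜 n = CS 𝕜 (Fin n) := by
  ext f
  constructor
  · rintro ⟨r, hr, h⟩
    lift r to ℝ≥0 using hr.le
    exact ⟨fun _ => r, fun _ => by exact_mod_cast hr, (summable_norm_iff_tsum_enorm f r).1 h⟩
  · rintro ⟨r, hr, h⟩
    obtain ⟨s, hs, hsr⟩ : ∃ s : ℝ≥0, 0 < s ∧ ∀ i, s ≤ r i := by
      rcases isEmpty_or_nonempty (Fin n) with hn | hn
      · exact ⟨1, one_pos, fun i => isEmptyElim i⟩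
      · obtain ⟨i, hi⟩ := Finite.exists_min r
        exact ⟨r i, hr i, hi⟩
    exact ⟨s, by exact_mod_cast hs,
      (summable_norm_iff_tsum_enorm f s).2 (ne_top_of_le_ne_top h (wnorm_mono hsr f))⟩

end AnalyticGerm

namespace AnalyticGerm

open scoped ENNReal NNReal
open MvPowerSeries

/-! ### The division algorithm as a convergent Neumann series. -/

section Division

variable {𝕜 : Type*} [RCLike 𝕜] {σ κ : Type*}

/-- The weighted `ℓ¹`-norm of a vector of power series. -/
noncomputable def vnorm (r : σ → ℝ≥0) (c : κ → ℝ≥0) (f : κ → MvPowerSeries σ 𝕜) : ℝ≥0∞ :=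
  ∑' p : (σ →₀ ℕ) × κ, ‖coeff p.1 (f p.2)‖ₑ * (monWeight r p.1 * c p.2)

theorem vnorm_eq_tsum_wnorm (r : σ → ℝ≥0) (c : κ → ℝ≥0) (f : κ → MvPowerSeries σ 𝕜) :
    vnorm r c f = ∑' k, wnorm r (f k) * c k := by
  unfold vnorm wnorm
  rw [ENNReal.tsum_prod', ENNReal.tsum_comm]
  refine tsum_congr fun k => ?_
  rw [← ENNReal.tsum_mul_right]
  refine tsum_congr fun a => ?_
  ring

theorem vnorm_zero (r : σ → ℝ≥0) (c : κ → ℝ≥0) : vnorm r c (0 : κ → MvPowerSeries σ 𝕜) = 0 := by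
  simp [vnorm]

theorem vnorm_add_le (r : σ → ℝ≥0) (c : κ → ℝ≥0) (f g : κ → MvPowerSeries σ 𝕜) :
    vnorm r c (f + g) ≤ vnorm r c f + vnorm r c g := by
  simp_rw [vnorm_eq_tsum_wnorm]
  rw [← ENNReal.tsum_add]
  refine ENNReal.tsum_le_tsum fun k => ?_
  rw [← add_mul]
  gcongr
  exact wnorm_add_le _ _ _

theorem vnorm_sum_le {ι : Type*} (s : Finset ι) (r : σ → ℝ≥0) (c : κ → ℝ≥0)
    (f : ι → κ → MvPowerSeries σ 𝕜) :
    vnorm r c (∑ i ∈ s, f i) ≤ ∑ i ∈ s, vnorm r c (f i) :=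
  Finset.le_sum_of_subadditive _ (vnorm_zero r c).le (vnorm_add_le r c) _ _

theorem vnorm_smul_le (r : σ → ℝ≥0) (c : κ → ℝ≥0) (g : MvPowerSeries σ 𝕜)
    (f : κ → MvPowerSeries σ 𝕜) : vnorm r c (g • f) ≤ wnorm r g * vnorm r c f := by
  simp_rw [vnorm_eq_tsum_wnorm]
  rw [← ENNReal.tsum_mul_left]
  refine ENNReal.tsum_le_tsum fun k => ?_
  rw [← mul_assoc]
  gcongr
  exact wnorm_mul_le _ _ _

open Classical in
/-- The part of `f` supported on `P`, divided by the monomial with exponent `a`. -/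
noncomputable def monQuot (a : σ →₀ ℕ) (P : (σ →₀ ℕ) → Prop) :
    MvPowerSeries σ 𝕜 →ₗ[𝕜] MvPowerSeries σ 𝕜 where
  toFun f := fun b => if P (b + a) then coeff (b + a) f else 0
  map_add' f g := by
    ext b
    change (if P (b + a) then coeff (b + a) (f + g) else 0) =
      (if P (b + a) then coeff (b + a) f else 0) + (if P (b + a) then coeff (b + a) g else 0)
    split_ifs <;> simp
  map_smul' t f := by
    ext b
    change (if P (b + a) then coeff (b + a) (t • f) else 0) =
      t * (if P (b + a) then coeff (b + a) f else 0)
    split_ifs <;> simp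

open Classical in
theorem coeff_monQuot (a b : σ →₀ ℕ) (P : (σ →₀ ℕ) → Prop) (f : MvPowerSeries σ 𝕜) :
    coeff b (monQuot a P f) = if P (b + a) then coeff (b + a) f else 0 := rfl

open Classical in
theorem coeff_monQuot_mul_monomial (a b : σ →₀ ℕ) (P : (σ →₀ ℕ) → Prop)
    (f : MvPowerSeries σ 𝕜) (hP : ∀ b, P b → a ≤ b) :
    coeff b (monQuot a P f * monomial a 1) = if P b then coeff b f else 0 := by
  rw [coeff_mul_monomial]
  by_cases h : a ≤ b
  · rw [if_pos h, mul_one, coeff_monQuot, tsub_add_cancel_of_le h]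
  · rw [if_neg h, if_neg fun hb => h (hP b hb)]

/-- Dividing by the monomial of exponent `a` costs at most the factor `r ^ a`, which is nonzero at a
positive polyradius. -/
theorem monQuot_mem_CS (a : σ →₀ ℕ) (P : (σ →₀ ℕ) → Prop) {f : MvPowerSeries σ 𝕜}
    (hf : f ∈ CS 𝕜 σ) : monQuot a P f ∈ CS 𝕜 σ := by
  classical
  obtain ⟨r, hr, hf⟩ := hf
  refine ⟨r, hr, fun h => hf ?_⟩
  have key : wnorm r (monQuot a P f) * monWeight r a ≤ wnorm r f := by
    unfold wnorm
    rw [← ENNReal.tsum_mul_right]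
    refine le_trans (ENNReal.tsum_le_tsum fun b => ?_)
      (ENNReal.tsum_comp_le_tsum_of_injective (add_left_injective a)
        fun b => ‖coeff b f‖ₑ * monWeight r b)
    rw [coeff_monQuot, mul_assoc, ← monWeight_add]
    split_ifs <;> simp
  rw [h, ENNReal.top_mul (monWeight_ne_zero hr a)] at key
  exact top_le_iff.1 key

section WithTopology

open scoped MvPowerSeries.WithPiTopology

theorem continuous_monQuot (a : σ →₀ ℕ) (P : (σ →₀ ℕ) → Prop) :
    Continuous (monQuot (𝕜 := 𝕜) a P) := by
  classical
  refine continuous_pi fun b => ?_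
  change Continuous fun f : MvPowerSeries σ 𝕜 => coeff b (monQuot a P f)
  simp_rw [coeff_monQuot]
  split_ifs
  · exact MvPowerSeries.WithPiTopology.continuous_coeff 𝕜 _
  · exact continuous_const

variable {ι : Type*} [Fintype ι] (a : ι → σ →₀ ℕ) (j : ι → κ)
  (asg : (σ →₀ ℕ) → κ → Option ι)

/-- One step of the division algorithm, with `t i` the negatives of the tails of the divisors. -/
noncomputable def divStep (t : ι → κ → MvPowerSeries σ 𝕜) :
    (κ → MvPowerSeries σ 𝕜) →ₗ[𝕜] (κ → MvPowerSeries σ 𝕜) where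
  toFun f := ∑ i, monQuot (a i) (fun b => asg b (j i) = some i) (f (j i)) • t i
  map_add' f g := by simp [add_smul, Finset.sum_add_distrib]
  map_smul' c f := by simp [Finset.smul_sum]

theorem continuous_divStep (t : ι → κ → MvPowerSeries σ 𝕜) :
    Continuous (divStep a j asg t) := by
  refine continuous_pi fun k => ?_
  simp only [divStep, LinearMap.coe_mk, AddHom.coe_mk, Finset.sum_apply, Pi.smul_apply, smul_eq_mul]
  exact continuous_finsetSum _ fun i _ => Continuous.mul
    ((continuous_monQuot (a i) _).comp (continuous_apply (j i))) continuous_const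

/-- Each monomial of `f` is assigned to at most one divisor, so the pieces of `f` that are divided
by the various leading monomials have disjoint supports. -/
theorem sum_wnorm_monQuot_le (r : σ → ℝ≥0) (c : κ → ℝ≥0) (f : κ → MvPowerSeries σ 𝕜) :
    ∑ i, wnorm r (monQuot (a i) (fun b => asg b (j i) = some i) (f (j i))) *
      (monWeight r (a i) * c (j i)) ≤ vnorm r c f := by
  classical
  have h : ∀ i, wnorm r (monQuot (a i) (fun b => asg b (j i) = some i) (f (j i))) *
      (monWeight r (a i) * c (j i)) ≤ ∑' p : (σ →₀ ℕ) × κ,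
        if asg p.1 p.2 = some i then ‖coeff p.1 (f p.2)‖ₑ * (monWeight r p.1 * c p.2) else 0 := by
    intro i
    unfold wnorm
    rw [← ENNReal.tsum_mul_right]
    have hinj : Function.Injective fun b : σ →₀ ℕ => (b + a i, j i) := fun b b' h => by
      simpa using h
    refine le_trans (ENNReal.tsum_le_tsum fun b => ?_)
      (ENNReal.tsum_comp_le_tsum_of_injective hinj _)
    simp only [coeff_monQuot]
    split_ifs
    · rw [monWeight_add]
      apply le_of_eq
      ring
    · simp
  refine (Finset.sum_le_sum fun i _ => h i).trans ?_
  rw [← Summable.tsum_finsetSum fun i _ => ENNReal.summable]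
  refine ENNReal.tsum_le_tsum fun p => ?_
  rcases hp : asg p.1 p.2 with _ | i₀
  · simp
  · simp

theorem vnorm_divStep_le (t : ι → κ → MvPowerSeries σ 𝕜) (r : σ → ℝ≥0) (c : κ → ℝ≥0)
    (ε : ℝ≥0∞) (ht : ∀ i, vnorm r c (t i) ≤ ε * (monWeight r (a i) * c (j i)))
    (f : κ → MvPowerSeries σ 𝕜) : vnorm r c (divStep a j asg t f) ≤ ε * vnorm r c f := by
  refine (vnorm_sum_le _ _ _ _).trans (le_trans ?_
    (mul_le_mul_right (sum_wnorm_monQuot_le a j asg r c f) ε))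
  rw [Finset.mul_sum]
  refine Finset.sum_le_sum fun i _ => (vnorm_smul_le _ _ _ _).trans ?_
  rw [mul_left_comm]
  gcongr
  exact ht i

/-- Convergence here is coefficientwise, and each coefficient is bounded by the norm up to a
positive weight. -/
theorem summable_of_vnorm {r : σ → ℝ≥0} {c : κ → ℝ≥0} (hr : ∀ i, 0 < r i) (hc : ∀ k, 0 < c k)
    {s : ℕ → κ → MvPowerSeries σ 𝕜} (hs : ∑' n, vnorm r c (s n) ≠ ∞) : Summable s := by
  refine Pi.summable.2 fun k => MvPowerSeries.WithPiTopology.summable_iff_summable_coeff.2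
    fun b => Summable.of_enorm fun h => hs ?_
  have hw : monWeight r b * c k ≠ 0 :=
    mul_ne_zero (monWeight_ne_zero hr b) (by simpa using (hc k).ne')
  have key : (∑' n, ‖coeff b (s n k)‖ₑ) * (monWeight r b * c k) ≤ ∑' n, vnorm r c (s n) := by
    rw [← ENNReal.tsum_mul_right]
    exact ENNReal.tsum_le_tsum fun n =>
      ENNReal.le_tsum (f := fun p : (σ →₀ ℕ) × κ =>
        ‖coeff p.1 (s n p.2)‖ₑ * (monWeight r p.1 * c p.2)) (b, k)
  rw [h, ENNReal.top_mul hw] at key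
  exact top_le_iff.1 key

theorem vnorm_tsum_le (r : σ → ℝ≥0) (c : κ → ℝ≥0) {s : ℕ → κ → MvPowerSeries σ 𝕜}
    (hs : Summable s) : vnorm r c (∑' n, s n) ≤ ∑' n, vnorm r c (s n) := by
  unfold vnorm
  rw [ENNReal.tsum_comm]
  refine ENNReal.tsum_le_tsum fun p => ?_
  rw [ENNReal.tsum_mul_right]
  gcongr
  have h : coeff p.1 ((∑' n, s n) p.2) = ∑' n, coeff p.1 (s n p.2) :=
    ((MvPowerSeries.WithPiTopology.hasSum_iff_hasSum_coeff.1
      (Pi.hasSum.1 hs.hasSum p.2) p.1).tsum_eq).symm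
  rw [h]
  exact enorm_tsum_le_tsum_enorm

/-- The step `T` contracts the norm by `ε < 1`, so `h = ∑ Tⁿ f` converges. Continuity of `T` in the
coefficientwise topology turns the series into a fixed point. -/
theorem exists_eq_add_divStep (t : ι → κ → MvPowerSeries σ 𝕜) {r : σ → ℝ≥0} {c : κ → ℝ≥0}
    (hr : ∀ i, 0 < r i) (hc : ∀ k, 0 < c k) {ε : ℝ≥0∞} (hε : ε < 1)
    (ht : ∀ i, vnorm r c (t i) ≤ ε * (monWeight r (a i) * c (j i)))
    {f : κ → MvPowerSeries σ 𝕜} (hf : vnorm r c f ≠ ∞) :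
    ∃ h, vnorm r c h ≠ ∞ ∧ h = f + divStep a j asg t h := by
  set T := divStep a j asg t
  let s : ℕ → κ → MvPowerSeries σ 𝕜 := fun n => (T ^ n) f
  have hs : ∀ n, vnorm r c (s n) ≤ ε ^ n * vnorm r c f := by
    intro n
    induction n with
    | zero => simp [s]
    | succ n ih =>
      have : s (n + 1) = T (s n) := by simp [s, pow_succ']
      rw [this, pow_succ', mul_assoc]
      exact (vnorm_divStep_le a j asg t r c ε ht _).trans (by gcongr)
  have hfin : ∑' n, vnorm r c (s n) ≠ ∞ := by
    refine ne_top_of_le_ne_top ?_ (ENNReal.tsum_le_tsum hs)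
    rw [ENNReal.tsum_mul_right, ENNReal.tsum_geometric]
    exact ENNReal.mul_ne_top (ENNReal.inv_ne_top.2 (tsub_pos_of_lt hε).ne') hf
  have hsum := summable_of_vnorm hr hc hfin
  refine ⟨∑' n, s n, ne_top_of_le_ne_top hfin (vnorm_tsum_le r c hsum), ?_⟩
  have hT : HasSum (fun n => T (s n)) (T (∑' n, s n)) :=
    hsum.hasSum.map T (continuous_divStep a j asg t)
  have h1 : ∀ n, T (s n) = s (n + 1) := fun n => by simp [s, pow_succ']
  simp_rw [h1] at hT
  rw [← hT.tsum_eq, hsum.tsum_eq_zero_add]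
  simp [s]

end WithTopology

variable {ι : Type*} [Fintype ι] (a : ι → σ →₀ ℕ) (j : ι → κ)
  (asg : (σ →₀ ℕ) → κ → Option ι)

open Classical in
/-- Division of `f` by vectors `g i` whose leading terms `x ^ a i • e (j i)` dominate the norm:
the remainder has no monomial assigned to a leading term. -/
theorem exists_division (hasg : ∀ b k i, asg b k = some i → a i ≤ b ∧ k = j i)
    (g : ι → κ → MvPowerSeries σ 𝕜) {r : σ → ℝ≥0} {c : κ → ℝ≥0}
    (hr : ∀ i, 0 < r i) (hc : ∀ k, 0 < c k) {ε : ℝ≥0∞} (hε : ε < 1)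
    (hg : ∀ i, vnorm r c (Pi.single (j i) (monomial (a i) 1) - g i) ≤
      ε * (monWeight r (a i) * c (j i)))
    {f : κ → MvPowerSeries σ 𝕜} (hf : vnorm r c f ≠ ∞) :
    ∃ q : ι → MvPowerSeries σ 𝕜, (∀ i, wnorm r (q i) ≠ ∞) ∧
      ∀ b k, asg b k ≠ none → coeff b ((f - ∑ i, q i • g i) k) = 0 := by
  let t : ι → κ → MvPowerSeries σ 𝕜 := fun i => Pi.single (j i) (monomial (a i) 1) - g i
  have hg' : ∀ i, vnorm r c (t i) ≤ ε * (monWeight r (a i) * c (j i)) := hg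
  obtain ⟨h, hh, heq⟩ := exists_eq_add_divStep a j asg t hr hc hε hg' hf
  refine ⟨fun i => monQuot (a i) (fun b => asg b (j i) = some i) (h (j i)), fun i htop => ?_,
    fun b k hbk => ?_⟩
  · have hw : monWeight r (a i) * c (j i) ≠ 0 :=
      mul_ne_zero (monWeight_ne_zero hr _) (by simpa using (hc (j i)).ne')
    have key := (Finset.single_le_sum (f := fun i => wnorm r (monQuot (a i)
      (fun b => asg b (j i) = some i) (h (j i))) * (monWeight r (a i) * c (j i)))
      (fun _ _ => zero_le) (Finset.mem_univ i)).trans (sum_wnorm_monQuot_le a j asg r c h)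
    rw [htop, ENNReal.top_mul hw] at key
    exact hh (top_le_iff.1 key)
  -- The fixed point equation reads `h = f + ∑ qᵢ (leadᵢ - gᵢ)`. Hence the remainder `f - ∑ qᵢ gᵢ`
  -- equals `h - ∑ qᵢ leadᵢ`, which is `h` with its assigned monomials deleted.
  · have hf' : f - ∑ i, monQuot (a i) (fun b => asg b (j i) = some i) (h (j i)) • g i =
        h - ∑ i, monQuot (a i) (fun b => asg b (j i) = some i) (h (j i)) •
          (Pi.single (j i) (monomial (a i) 1) : κ → MvPowerSeries σ 𝕜) := by
      have h2 : f = h - ∑ i, monQuot (a i) (fun b => asg b (j i) = some i) (h (j i)) •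
          (Pi.single (j i) (monomial (a i) 1) - g i) := eq_sub_of_add_eq heq.symm
      nth_rw 1 [h2]
      simp_rw [smul_sub, Finset.sum_sub_distrib]
      abel
    rw [hf']
    obtain ⟨i₀, hi₀⟩ := Option.ne_none_iff_exists'.1 hbk
    have hterm : ∀ i, coeff b ((monQuot (a i) (fun b => asg b (j i) = some i) (h (j i)) •
        (Pi.single (j i) (monomial (a i) 1) : κ → MvPowerSeries σ 𝕜)) k) =
        if i = i₀ then coeff b (h k) else 0 := by
      intro i
      by_cases hk : k = j i
      · subst hk
        rw [Pi.smul_apply, Pi.single_eq_same, smul_eq_mul, coeff_monQuot_mul_monomial _ _ _ _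
          fun b hb => (hasg b _ i hb).1, hi₀]
        simp [eq_comm]
      · rw [Pi.smul_apply, Pi.single_eq_of_ne hk, smul_zero, map_zero, if_neg]
        rintro rfl
        exact hk (hasg b k i hi₀).2
    rw [Pi.sub_apply, Finset.sum_apply, map_sub, map_sum, Finset.sum_congr rfl fun i _ => hterm i]
    simp

end Division
end AnalyticGerm

namespace AnalyticGerm

open scoped ENNReal NNReal
open MvPowerSeries Filter Topology

/-! ### A monomial order realised by radii, and domination by leading monomials. -/

section Weights

variable {𝕜 : Type*} [RCLike 𝕜] {σ κ : Type*}

/-- The exponent `a` only involves variables outside `w`. -/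
def Off (w : Set σ) (a : σ →₀ ℕ) : Prop := ∀ i ∈ w, a i = 0

theorem Off.zero (w : Set σ) : Off w 0 := fun _ _ => rfl

open Classical in
/-- The polyradius `r` with the radii of the variables in `w` multiplied by `s`. -/
noncomputable def shrink (w : Set σ) (s : ℝ≥0) (r : σ → ℝ≥0) : σ → ℝ≥0 :=
  fun i => if i ∈ w then s * r i else r i

theorem shrink_pos {w : Set σ} {s : ℝ≥0} {r : σ → ℝ≥0} (hs : 0 < s) (hr : ∀ i, 0 < r i) (i : σ) :
    0 < shrink w s r i := by
  unfold shrink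
  split_ifs
  · exact mul_pos hs (hr i)
  · exact hr i

theorem shrink_le {w : Set σ} {s : ℝ≥0} (r : σ → ℝ≥0) (hs : s ≤ 1) : shrink w s r ≤ r := by
  intro i
  unfold shrink
  split_ifs
  · exact mul_le_of_le_one_left zero_le hs
  · exact le_rfl

theorem monWeight_shrink_of_off {w : Set σ} {a : σ →₀ ℕ} (ha : Off w a) (s : ℝ≥0)
    (r : σ → ℝ≥0) : monWeight (shrink w s r) a = monWeight r a := by
  unfold monWeight Finsupp.prod
  refine Finset.prod_congr rfl fun i hi => ?_
  have h : shrink w s r i = r i := if_neg fun h => Finsupp.mem_support_iff.1 hi (ha i h)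
  simp only [h]

theorem monWeight_shrink_of_not_off {w : Set σ} {a : σ →₀ ℕ} (ha : ¬ Off w a) {s : ℝ≥0}
    (hs : s ≤ 1) (r : σ → ℝ≥0) : monWeight (shrink w s r) a ≤ s * monWeight r a := by
  classical
  unfold Off at ha
  push Not at ha
  obtain ⟨i, hi, hai⟩ := ha
  obtain ⟨b, rfl⟩ : ∃ b, a = Finsupp.single i 1 + b :=
    ⟨a - Finsupp.single i 1, (add_tsub_cancel_of_le (by
      rw [Finsupp.single_le_iff]; exact Nat.one_le_iff_ne_zero.2 hai)).symm⟩
  rw [monWeight_add, monWeight_add, monWeight_single, monWeight_single, ← mul_assoc]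
  refine mul_le_mul' (le_of_eq ?_) (monWeight_mono (shrink_le r hs) b)
  rw [shrink, if_pos hi, ENNReal.coe_mul]

/-- The part of `f` whose exponents do not involve the variables in `w`. -/
noncomputable def offPart (w : Set σ) (f : κ → MvPowerSeries σ 𝕜) : κ → MvPowerSeries σ 𝕜 :=
  fun k => monQuot 0 (Off w) (f k)

open Classical in
theorem coeff_offPart (w : Set σ) (f : κ → MvPowerSeries σ 𝕜) (a : σ →₀ ℕ) (k : κ) :
    coeff a (offPart w f k) = if Off w a then coeff a (f k) else 0 := by
  rw [offPart, coeff_monQuot, add_zero]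

/-- Terms free of the variables in `w` keep their weight; every other term contains such a variable
and gains at least one factor `s`. -/
theorem vnorm_shrink_le (w : Set σ) {s : ℝ≥0} (hs : s ≤ 1) (r : σ → ℝ≥0) (c : κ → ℝ≥0)
    (f : κ → MvPowerSeries σ 𝕜) :
    vnorm (shrink w s r) c f ≤ vnorm r c (offPart w f) + s * vnorm r c f := by
  unfold vnorm
  rw [← ENNReal.tsum_mul_left, ← ENNReal.tsum_add]
  refine ENNReal.tsum_le_tsum fun p => ?_
  rw [coeff_offPart]
  by_cases h : Off w p.1
  · rw [if_pos h, monWeight_shrink_of_off h]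
    exact le_self_add
  · rw [if_neg h, enorm_zero, zero_mul, zero_add]
    refine (mul_le_mul_right (mul_le_mul_left (monWeight_shrink_of_not_off h hs r) _) _).trans
      (le_of_eq ?_)
    ring

theorem vnorm_mono {r r' : σ → ℝ≥0} (h : r ≤ r') (c : κ → ℝ≥0) (f : κ → MvPowerSeries σ 𝕜) :
    vnorm r c f ≤ vnorm r' c f :=
  ENNReal.tsum_le_tsum fun p => by gcongr; exact monWeight_mono h _

theorem vnorm_ne_top [Finite κ] {r : σ → ℝ≥0} (c : κ → ℝ≥0) {f : κ → MvPowerSeries σ 𝕜}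
    (h : ∀ k, wnorm r (f k) ≠ ∞) : vnorm r c f ≠ ∞ := by
  cases nonempty_fintype κ
  rw [vnorm_eq_tsum_wnorm, tsum_fintype]
  exact ENNReal.sum_ne_top.2 fun k _ => ENNReal.mul_ne_top (h k) ENNReal.coe_ne_top

/-- The natural number encoding a monomial of a free module through distinct primes. -/
noncomputable def primeCode (p : σ ⊕ κ → ℕ) (a : σ →₀ ℕ) (k : κ) : ℕ :=
  (a.prod fun i n => p (Sum.inl i) ^ n) * p (Sum.inr k)

theorem primeCode_pos {p : σ ⊕ κ → ℕ} (hp : ∀ x, (p x).Prime) (a : σ →₀ ℕ) (k : κ) :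
    0 < primeCode p a k := by
  unfold primeCode Finsupp.prod
  exact mul_pos (Finset.prod_pos fun i _ => pow_pos (hp _).pos _) (hp _).pos

/-- Unique factorisation: the exponents and the component are read off from the factorisation of the
code. -/
theorem primeCode_injective {p : σ ⊕ κ → ℕ} (hp : ∀ x, (p x).Prime) (hinj : Function.Injective p)
    {a b : σ →₀ ℕ} {k l : κ} (h : primeCode p a k = primeCode p b l) : a = b ∧ k = l := by
  classical
  let e : σ ⊕ κ ↪ ℕ := ⟨p, hinj⟩
  have key : ∀ (a : σ →₀ ℕ) (k : κ), (primeCode p a k).factorization =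
      Finsupp.embDomain e (a.sumElim (Finsupp.single k 1)) := by
    intro a k
    have h1 : primeCode p a k =
        (Finsupp.embDomain e (a.sumElim (Finsupp.single k 1))).prod fun x n => x ^ n := by
      rw [Finsupp.prod_embDomain, primeCode, Finsupp.prod_sumElim]
      have h2 : (Finsupp.single k 1).prod ((fun x n => e x ^ n) ∘ Sum.inr) = p (Sum.inr k) := by
        rw [Finsupp.prod_single_index] <;> simp [e]
      rw [h2]
      rfl
    rw [h1]
    refine Nat.prod_pow_factorization_eq_self fun q hq => ?_
    rw [Finsupp.support_embDomain, Finset.mem_map] at hq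
    obtain ⟨x, -, rfl⟩ := hq
    exact hp x
  have h2 := key a k
  rw [h, key b l] at h2
  have h3 := Finsupp.embDomain_injective e h2
  constructor
  · ext i
    simpa using (DFunLike.congr_fun h3 (Sum.inl i)).symm
  · have := DFunLike.congr_fun h3 (Sum.inr k)
    by_contra hne
    simp [hne] at this

/-- The radii `p ^ (-t)`. -/
noncomputable def primeRadius {α : Type*} (p : α → ℕ) (t : ℕ) (x : α) : ℝ≥0 := ((p x : ℝ≥0)⁻¹) ^ t

theorem primeRadius_pos {α : Type*} {p : α → ℕ} (hp : ∀ x, (p x).Prime) (t : ℕ) (x : α) :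
    0 < primeRadius p t x :=
  pow_pos (inv_pos.2 (by exact_mod_cast (hp x).pos)) _

/-- This identity links the order by codes with the norms: larger codes become negligible against
smaller ones as `t` grows. -/
theorem weight_primeRadius {p : σ ⊕ κ → ℕ} (hp : ∀ x, (p x).Prime) (t : ℕ) (a : σ →₀ ℕ) (k : κ) :
    monWeight (primeRadius (p ∘ Sum.inl) t) a * primeRadius (p ∘ Sum.inr) t k =
      ((primeCode p a k : ℝ≥0∞)⁻¹) ^ t := by
  have hc : ∀ x (n : ℕ), ((primeRadius p n x : ℝ≥0) : ℝ≥0∞) = ((p x : ℝ≥0∞)⁻¹) ^ n := by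
    intro x n
    unfold primeRadius
    rw [ENNReal.coe_pow, ENNReal.coe_inv (by exact_mod_cast (hp x).ne_zero)]
    simp
  have h1 : monWeight (primeRadius (p ∘ Sum.inl) t) a =
      (((a.prod fun i n => p (Sum.inl i) ^ n : ℕ) : ℝ≥0∞)⁻¹) ^ t := by
    unfold monWeight Finsupp.prod
    push_cast
    rw [ENNReal.prod_inv_distrib, ← Finset.prod_pow]
    · refine Finset.prod_congr rfl fun i _ => ?_
      change ((primeRadius p t (Sum.inl i) : ℝ≥0) : ℝ≥0∞) ^ _ = _
      rw [hc, ← ENNReal.inv_pow, ← ENNReal.inv_pow, ← ENNReal.inv_pow, ← pow_mul, ← pow_mul,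
        mul_comm]
    · intro i _ j _ _
      right
      exact ENNReal.pow_ne_top (ENNReal.natCast_ne_top _)
  rw [h1]
  change _ * ((primeRadius p t (Sum.inr k) : ℝ≥0) : ℝ≥0∞) = _
  rw [hc, ← mul_pow, primeCode, Nat.cast_mul, ENNReal.mul_inv]
  · right; exact ENNReal.natCast_ne_top _
  · left; exact ENNReal.natCast_ne_top _

theorem eventually_wnorm_primeRadius_ne_top [Finite σ] {p : σ → ℕ} (hp : ∀ x, (p x).Prime)
    {f : MvPowerSeries σ 𝕜} (hf : f ∈ CS 𝕜 σ) :
    ∀ᶠ t in atTop, wnorm (primeRadius p t) f ≠ ∞ := by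
  obtain ⟨r, hr, hf⟩ := hf
  have h : ∀ i, ∀ᶠ t in atTop, primeRadius p t i ≤ r i := by
    intro i
    have h1 : Tendsto (fun t => primeRadius p t i) atTop (𝓝 0) :=
      NNReal.tendsto_pow_atTop_nhds_zero_of_lt_one (r := (p i : ℝ≥0)⁻¹)
        (inv_lt_one_of_one_lt₀ (by exact_mod_cast (hp i).one_lt))
    exact h1.eventually_le_const (hr i)
  filter_upwards [eventually_all.2 h] with t ht
  exact ne_top_of_le_ne_top hf (wnorm_mono ht f)

theorem vnorm_primeRadius_add_le {p : σ ⊕ κ → ℕ} (hp : ∀ x, (p x).Prime)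
    {f : κ → MvPowerSeries σ 𝕜} {m : ℕ}
    (hf : ∀ a k, coeff a (f k) ≠ 0 → m ≤ primeCode p a k) (t₀ t : ℕ) :
    vnorm (primeRadius (p ∘ Sum.inl) (t₀ + t)) (primeRadius (p ∘ Sum.inr) (t₀ + t)) f ≤
      ((m : ℝ≥0∞)⁻¹) ^ t *
        vnorm (primeRadius (p ∘ Sum.inl) t₀) (primeRadius (p ∘ Sum.inr) t₀) f := by
  unfold vnorm
  rw [← ENNReal.tsum_mul_left]
  refine ENNReal.tsum_le_tsum fun q => ?_
  rw [weight_primeRadius hp, weight_primeRadius hp, pow_add]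
  by_cases h : coeff q.1 (f q.2) = 0
  · simp [h]
  · rw [mul_comm (_ ^ t₀), mul_left_comm]
    gcongr
    exact hf _ _ h

/-- A vector all of whose monomials have a code greater than that of `(a, k)` is eventually
dominated by the monomial `(a, k)`. -/
theorem eventually_vnorm_primeRadius_le {p : σ ⊕ κ → ℕ} (hp : ∀ x, (p x).Prime)
    {f : κ → MvPowerSeries σ 𝕜} {a : σ →₀ ℕ} {k : κ}
    (hf : ∀ b l, coeff b (f l) ≠ 0 → primeCode p a k < primeCode p b l) {t₀ : ℕ}
    (ht₀ : vnorm (primeRadius (p ∘ Sum.inl) t₀) (primeRadius (p ∘ Sum.inr) t₀) f ≠ ∞)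
    {ε : ℝ≥0∞} (hε : 0 < ε) :
    ∀ᶠ t in atTop, vnorm (primeRadius (p ∘ Sum.inl) t) (primeRadius (p ∘ Sum.inr) t) f ≤
      ε * (monWeight (primeRadius (p ∘ Sum.inl) t) a * primeRadius (p ∘ Sum.inr) t k) := by
  set m := primeCode p a k with hm
  set V := vnorm (primeRadius (p ∘ Sum.inl) t₀) (primeRadius (p ∘ Sum.inr) t₀) f
  have hm0 : (m : ℝ≥0∞) ≠ 0 := by exact_mod_cast (primeCode_pos hp a k).ne'
  have hmt : (m : ℝ≥0∞) ≠ ∞ := ENNReal.natCast_ne_top _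
  -- Codes are integers, so every monomial of `f` has code at least `m + 1`. Compared with the
  -- weight of `(a, k)`, the norm therefore decays like `(m / (m + 1)) ^ t`.
  have hlt : (m : ℝ≥0∞) * ((m + 1 : ℕ) : ℝ≥0∞)⁻¹ < 1 := by
    rw [← div_eq_mul_inv, ENNReal.div_lt_iff (by simp) (by simp), one_mul]
    exact_mod_cast Nat.lt_succ_self m
  have hlim : Tendsto (fun t => ((m : ℝ≥0∞) * ((m + 1 : ℕ) : ℝ≥0∞)⁻¹) ^ t * ((m : ℝ≥0∞) ^ t₀ * V))
      atTop (𝓝 (0 * ((m : ℝ≥0∞) ^ t₀ * V))) :=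
    ENNReal.Tendsto.mul_const (ENNReal.tendsto_pow_atTop_nhds_zero_of_lt_one hlt)
      (Or.inr (ENNReal.mul_ne_top (ENNReal.pow_ne_top hmt) ht₀))
  rw [zero_mul] at hlim
  have hev := (tendsto_sub_atTop_nat t₀).eventually (hlim.eventually_le_const hε)
  filter_upwards [hev, eventually_ge_atTop t₀] with t ht hle
  obtain ⟨t, rfl⟩ := Nat.exists_eq_add_of_le hle
  rw [Nat.add_sub_cancel_left] at ht
  rw [weight_primeRadius hp, ← hm]
  refine (vnorm_primeRadius_add_le hp (m := m + 1) (fun b l h => hf b l h) t₀ t).trans ?_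
  calc (((m + 1 : ℕ) : ℝ≥0∞)⁻¹) ^ t * V
      = (((m : ℝ≥0∞) * ((m + 1 : ℕ) : ℝ≥0∞)⁻¹) ^ t * ((m : ℝ≥0∞) ^ t₀ * V)) *
          ((m : ℝ≥0∞)⁻¹) ^ (t₀ + t) := by
        have h1 : (m : ℝ≥0∞) ^ t₀ * ((m : ℝ≥0∞)⁻¹) ^ t₀ = 1 := by
          rw [← mul_pow, ENNReal.mul_inv_cancel hm0 hmt, one_pow]
        have h2 : (m : ℝ≥0∞) ^ t * ((m : ℝ≥0∞)⁻¹) ^ t = 1 := by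
          rw [← mul_pow, ENNReal.mul_inv_cancel hm0 hmt, one_pow]
        rw [mul_pow, pow_add]
        calc _ = ((m : ℝ≥0∞) ^ t₀ * ((m : ℝ≥0∞)⁻¹) ^ t₀) * ((m : ℝ≥0∞) ^ t * ((m : ℝ≥0∞)⁻¹) ^ t) *
              ((((m + 1 : ℕ) : ℝ≥0∞)⁻¹) ^ t * V) := by rw [h1, h2, one_mul, one_mul]
          _ = _ := by ring
    _ ≤ _ := by gcongr

/-- `(a, k)` is the leading monomial of `f` among the exponents not involving `w`, with
coefficient one. -/
def HasLeading (w : Set σ) (p : σ ⊕ κ → ℕ) (f : κ → MvPowerSeries σ 𝕜) (a : σ →₀ ℕ) (k : κ) :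
    Prop :=
  Off w a ∧ coeff a (f k) = 1 ∧
    ∀ b l, Off w b → coeff b (f l) ≠ 0 → (b = a ∧ l = k) ∨ primeCode p a k < primeCode p b l

open Classical in
/-- Finitely many convergent vectors are simultaneously dominated by their leading monomials on
suitable small polydiscs. -/
theorem exists_dominating_radius [Finite σ] [Finite κ] {ι : Type*} [Finite ι] (w : Set σ)
    {p : σ ⊕ κ → ℕ} (hp : ∀ x, (p x).Prime) (g : ι → κ → MvPowerSeries σ 𝕜)
    (hg : ∀ i k, g i k ∈ CS 𝕜 σ) (a : ι → σ →₀ ℕ) (j : ι → κ)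
    (hlead : ∀ i, HasLeading w p (g i) (a i) (j i)) {f : κ → MvPowerSeries σ 𝕜}
    (hf : ∀ k, f k ∈ CS 𝕜 σ) :
    ∃ (r : σ → ℝ≥0) (c : κ → ℝ≥0), (∀ i, 0 < r i) ∧ (∀ k, 0 < c k) ∧ vnorm r c f ≠ ∞ ∧
      ∀ i, vnorm r c (Pi.single (j i) (monomial (a i) 1) - g i) ≤
        2⁻¹ * (monWeight r (a i) * c (j i)) := by
  let T : ι → κ → MvPowerSeries σ 𝕜 := fun i => Pi.single (j i) (monomial (a i) 1) - g i
  have hT : ∀ i k, T i k ∈ CS 𝕜 σ := by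
    intro i k
    refine sub_mem ?_ (hg i k)
    by_cases hk : k = j i
    · subst hk
      rw [Pi.single_eq_same]
      exact hasPolyradius_monomial _ _
    · rw [Pi.single_eq_of_ne hk]
      exact zero_mem _
  have hp' : ∀ x, ((p ∘ Sum.inl) x).Prime := fun x => hp _
  have h1 : ∀ᶠ t in atTop, ∀ k, wnorm (primeRadius (p ∘ Sum.inl) t) (f k) ≠ ∞ :=
    eventually_all.2 fun k => eventually_wnorm_primeRadius_ne_top hp' (hf k)
  have h2 : ∀ᶠ t in atTop, ∀ i k, wnorm (primeRadius (p ∘ Sum.inl) t) (T i k) ≠ ∞ :=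
    eventually_all.2 fun i => eventually_all.2 fun k =>
      eventually_wnorm_primeRadius_ne_top hp' (hT i k)
  -- The allowance `1/2` is split into two quarters: one for the tail not involving `w`, handled by
  -- large `t`, and one for the terms involving `w`, handled afterwards by shrinking the radii in
  -- `w`. The leading weights do not involve `w` and survive the shrinking.
  have h3 : ∀ i, ∀ᶠ t in atTop,
      vnorm (primeRadius (p ∘ Sum.inl) t) (primeRadius (p ∘ Sum.inr) t) (offPart w (T i)) ≤
      4⁻¹ * (monWeight (primeRadius (p ∘ Sum.inl) t) (a i) *
        primeRadius (p ∘ Sum.inr) t (j i)) := by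
    intro i
    have hoff : ∀ k, offPart w (T i) k ∈ CS 𝕜 σ := fun k => monQuot_mem_CS _ _ (hT i k)
    have h4 : ∀ᶠ t in atTop, ∀ k, wnorm (primeRadius (p ∘ Sum.inl) t) (offPart w (T i) k) ≠ ∞ :=
      eventually_all.2 fun k => eventually_wnorm_primeRadius_ne_top hp' (hoff k)
    obtain ⟨t₀, ht₀⟩ := h4.exists
    refine eventually_vnorm_primeRadius_le hp ?_
      (vnorm_ne_top (primeRadius (p ∘ Sum.inr) t₀) ht₀) (by simp)
    intro b l hb
    rw [coeff_offPart] at hb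
    have hboff : Off w b := by
      by_contra h
      simp [h] at hb
    rw [if_pos hboff] at hb
    have hTi : T i l = (Pi.single (j i) (monomial (a i) 1) : κ → MvPowerSeries σ 𝕜) l - g i l := rfl
    rw [hTi, map_sub] at hb
    by_cases hbl : b = a i ∧ l = j i
    · obtain ⟨rfl, rfl⟩ := hbl
      rw [Pi.single_eq_same, coeff_monomial_same, (hlead i).2.1, sub_self] at hb
      exact absurd rfl hb
    · have hz : coeff b ((Pi.single (j i) (monomial (a i) 1) : κ → MvPowerSeries σ 𝕜) l) = 0 := by
        by_cases hl : l = j i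
        · subst hl
          rw [Pi.single_eq_same, coeff_monomial_ne fun h => hbl ⟨h, rfl⟩]
        · rw [Pi.single_eq_of_ne hl, map_zero]
      rw [hz, zero_sub, neg_ne_zero] at hb
      exact ((hlead i).2.2 b l hboff hb).resolve_left hbl
  obtain ⟨t, ht1, ht2, ht3⟩ := (h1.and (h2.and (eventually_all.2 h3))).exists
  set r := primeRadius (p ∘ Sum.inl) t with hr
  set c := primeRadius (p ∘ Sum.inr) t with hc
  have hrpos : ∀ i, 0 < r i := primeRadius_pos hp' t
  have hcpos : ∀ k, 0 < c k := primeRadius_pos (fun x => hp _) t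
  have h5 : ∀ i, ∀ᶠ n : ℕ in atTop, ((2⁻¹ : ℝ≥0∞)) ^ n * vnorm r c (T i) ≤
      4⁻¹ * (monWeight r (a i) * c (j i)) := by
    intro i
    have hlim : Tendsto (fun n => ((2⁻¹ : ℝ≥0∞)) ^ n * vnorm r c (T i)) atTop
        (𝓝 (0 * vnorm r c (T i))) :=
      ENNReal.Tendsto.mul_const (ENNReal.tendsto_pow_atTop_nhds_zero_of_lt_one (by
        exact ENNReal.inv_lt_one.2 (by norm_num))) (Or.inr (vnorm_ne_top c (ht2 i)))
    rw [zero_mul] at hlim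
    refine hlim.eventually_le_const (pos_iff_ne_zero.2 (mul_ne_zero (by simp) (mul_ne_zero
      (monWeight_ne_zero hrpos _) (by simpa using (hcpos _).ne'))))
  obtain ⟨n, hn⟩ := (eventually_all.2 h5).exists
  have hs1 : (2⁻¹ : ℝ≥0) ^ n ≤ 1 := pow_le_one₀ zero_le (by
    rw [inv_le_one₀ (by norm_num)]; norm_num)
  refine ⟨shrink w (2⁻¹ ^ n) r, c, shrink_pos (by positivity) hrpos, hcpos,
    ne_top_of_le_ne_top (vnorm_ne_top c ht1) (vnorm_mono (shrink_le r hs1) c f), fun i => ?_⟩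
  rw [monWeight_shrink_of_off (hlead i).1]
  refine (vnorm_shrink_le w hs1 r c (T i)).trans ?_
  have h42 : (2⁻¹ : ℝ≥0∞) = 4⁻¹ + 4⁻¹ := by
    rw [← two_mul, show (4 : ℝ≥0∞) = 2 * 2 by norm_num, ENNReal.mul_inv (by simp) (by simp),
      ← mul_assoc, ENNReal.mul_inv_cancel (by simp) (by simp), one_mul]
  rw [h42, add_mul]
  refine add_le_add (ht3 i) ?_
  have := hn i
  push_cast
  exact this

end Weights
end AnalyticGerm

namespace AnalyticGerm

open scoped ENNReal NNReal
open MvPowerSeries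

/-! ### Division by a submodule; Noetherianity and locality of the convergent series. -/

section Submodules

variable {𝕜 : Type*} [RCLike 𝕜] {σ κ : Type*}

theorem exists_distinct_primes (α : Type*) [Finite α] :
    ∃ p : α → ℕ, (∀ x, (p x).Prime) ∧ Function.Injective p := by
  obtain ⟨e⟩ : Nonempty (α ↪ {p : ℕ // p.Prime}) := by
    cases nonempty_fintype α
    have : Infinite {p : ℕ // p.Prime} := Nat.infinite_setOfPred_prime.to_subtype
    exact ⟨(Fintype.equivFin α).toEmbedding.trans
      (Fin.valEmbedding.trans (Infinite.natEmbedding _))⟩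
  exact ⟨fun x => e x, fun x => (e x).2, fun x y h => e.injective (Subtype.ext h)⟩

/-- The underlying vector of formal power series. -/
def toMv (f : κ → CS 𝕜 σ) : κ → MvPowerSeries σ 𝕜 := fun k => f k

/-- The exponents of the leading monomials, in the component `k`, of the elements of `N`. -/
def leadingExponents (w : Set σ) (p : σ ⊕ κ → ℕ) (N : Submodule (CS 𝕜 σ) (κ → CS 𝕜 σ)) (k : κ) :
    Set (σ →₀ ℕ) :=
  {a | ∃ f ∈ N, HasLeading w p (toMv f) a k}

/-- The vectors without monomials divisible by a leading monomial of `N`. -/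
def IsReduced (w : Set σ) (p : σ ⊕ κ → ℕ) (N : Submodule (CS 𝕜 σ) (κ → CS 𝕜 σ))
    (f : κ → CS 𝕜 σ) : Prop :=
  ∀ k, ∀ a ∈ leadingExponents w p N k, ∀ b, a ≤ b → coeff b (f k : MvPowerSeries σ 𝕜) = 0

/-- Dickson's lemma: the minimal elements form an antichain in a well-quasi-order. -/
theorem exists_finset_minimal [Finite σ] (E : Set (σ →₀ ℕ)) :
    ∃ G : Set (σ →₀ ℕ), G.Finite ∧ G ⊆ E ∧ ∀ a ∈ E, ∃ g ∈ G, g ≤ a := by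
  refine ⟨{a | Minimal (· ∈ E) a}, WellQuasiOrderedLE.finite_of_isAntichain
    (setOfPred_minimal_antichain _), fun a ha => ha.prop, fun a ha => ?_⟩
  obtain ⟨g, hg, h⟩ := exists_minimal_le_of_wellFoundedLT (· ∈ E) a ha
  exact ⟨g, h, hg⟩

/-- Hironaka division by a submodule. -/
theorem exists_finset_division [Finite σ] [Finite κ] (w : Set σ) {p : σ ⊕ κ → ℕ}
    (hp : ∀ x, (p x).Prime) (N : Submodule (CS 𝕜 σ) (κ → CS 𝕜 σ)) :
    ∃ s : Set (κ → CS 𝕜 σ), s.Finite ∧ s ⊆ N ∧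
      ∀ f, ∃ g ∈ Submodule.span (CS 𝕜 σ) s, IsReduced w p N (f - g) := by
  classical
  choose G hGfin hGsub hG using fun k => exists_finset_minimal (leadingExponents w p N k)
  let ι := Σ k, G k
  have : ∀ k, Finite (G k) := fun k => (hGfin k).to_subtype
  cases nonempty_fintype ι
  choose g hgN hglead using fun i : ι => hGsub i.1 i.2.2
  -- Each monomial divisible by some chosen leading monomial is assigned to one of them; the
  -- unassigned monomials are exactly those allowed in the remainder.
  let asg : (σ →₀ ℕ) → κ → Option ι := fun b k =>
    if h : ∃ a : G k, (a : σ →₀ ℕ) ≤ b then some ⟨k, h.choose⟩ else none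
  have hasg : ∀ b k (i : ι), asg b k = some i → (i.2 : σ →₀ ℕ) ≤ b ∧ k = i.1 := by
    intro b k i hi
    by_cases h : ∃ a : G k, (a : σ →₀ ℕ) ≤ b
    · simp only [asg, dif_pos h, Option.some.injEq] at hi
      subst hi
      exact ⟨h.choose_spec, rfl⟩
    · simp only [asg, dif_neg h] at hi
      cases hi
  refine ⟨Set.range g, Set.finite_range g, Set.range_subset_iff.2 hgN, fun f => ?_⟩
  obtain ⟨r, c, hr, hc, hf, hdom⟩ := exists_dominating_radius w hp (fun i => toMv (g i))
    (fun i k => (g i k).2) (fun i => (i.2 : σ →₀ ℕ)) (fun i => i.1) hglead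
    (f := toMv f) (fun k => (f k).2)
  have h2 : (2⁻¹ : ℝ≥0∞) < 1 := ENNReal.inv_lt_one.2 (by norm_num)
  obtain ⟨q, hq, hrem⟩ := exists_division (fun i : ι => (i.2 : σ →₀ ℕ)) (fun i => i.1) asg hasg
    (fun i => toMv (g i)) hr hc h2 hdom hf
  let q' : ι → CS 𝕜 σ := fun i => ⟨q i, r, hr, hq i⟩
  refine ⟨∑ i, q' i • g i, Submodule.sum_mem _ fun i _ => Submodule.smul_mem _ _
    (Submodule.subset_span ⟨i, rfl⟩), fun k a ha b hab => ?_⟩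
  have hne : asg b k ≠ none := by
    obtain ⟨a', ha', hle⟩ := hG k a ha
    have h : ∃ a : G k, (a : σ →₀ ℕ) ≤ b := ⟨⟨a', ha'⟩, hle.trans hab⟩
    simp only [asg, dif_pos h]
    exact Option.some_ne_none _
  have := hrem b k hne
  convert this using 2
  simp [toMv, q']

/-- Codes are natural numbers, so a monomial of least code exists among those outside `w`;
injectivity of the code makes it unique, and scaling makes its coefficient one. -/
theorem exists_leadingExponent {w : Set σ} {p : σ ⊕ κ → ℕ} (hp : ∀ x, (p x).Prime)
    (hinj : Function.Injective p) {N : Submodule (CS 𝕜 σ) (κ → CS 𝕜 σ)} {f : κ → CS 𝕜 σ}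
    (hf : f ∈ N) (hne : ∃ a k, Off w a ∧ coeff a (f k : MvPowerSeries σ 𝕜) ≠ 0) :
    ∃ k, ∃ a ∈ leadingExponents w p N k, Off w a ∧ coeff a (f k : MvPowerSeries σ 𝕜) ≠ 0 := by
  classical
  have hex : ∃ n a k, Off w a ∧ coeff a (f k : MvPowerSeries σ 𝕜) ≠ 0 ∧ primeCode p a k = n := by
    obtain ⟨a, k, h1, h2⟩ := hne
    exact ⟨_, a, k, h1, h2, rfl⟩
  obtain ⟨a, k, h1, h2, h3⟩ := Nat.find_spec hex
  set c := coeff a (f k : MvPowerSeries σ 𝕜) with hc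
  have hcoeff : ∀ b l, coeff b (toMv ((algebraMap 𝕜 (CS 𝕜 σ) c⁻¹) • f) l) =
      c⁻¹ * coeff b (f l : MvPowerSeries σ 𝕜) := by
    intro b l
    rw [algebraMap_smul]
    simp [toMv]
  refine ⟨k, a, ⟨algebraMap 𝕜 (CS 𝕜 σ) c⁻¹ • f, N.smul_mem _ hf, h1, ?_, fun b l hb hbl => ?_⟩,
    h1, h2⟩
  · rw [hcoeff, inv_mul_cancel₀ h2]
  · rw [hcoeff] at hbl
    have hle := Nat.find_min' hex ⟨b, l, hb, right_ne_zero_of_mul hbl, rfl⟩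
    rw [← h3] at hle
    rcases hle.lt_or_eq with h | h
    · exact Or.inr h
    · obtain ⟨rfl, rfl⟩ := primeCode_injective hp hinj h
      exact Or.inl ⟨rfl, rfl⟩

theorem coeff_eq_zero_of_isReduced {w : Set σ} {p : σ ⊕ κ → ℕ} (hp : ∀ x, (p x).Prime)
    (hinj : Function.Injective p) {N : Submodule (CS 𝕜 σ) (κ → CS 𝕜 σ)} {f : κ → CS 𝕜 σ}
    (hf : f ∈ N) (hred : IsReduced w p N f) (a : σ →₀ ℕ) (k : κ) (ha : Off w a) :
    coeff a (f k : MvPowerSeries σ 𝕜) = 0 := by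
  by_contra h
  obtain ⟨k, a, ha, -, h⟩ := exists_leadingExponent hp hinj hf ⟨a, k, ha, h⟩
  exact h (hred k a ha a le_rfl)

/-- The Rückert basis theorem. -/
instance isNoetherianRing_CS [Finite σ] : IsNoetherianRing (CS 𝕜 σ) := by
  obtain ⟨p, hp, hinj⟩ := exists_distinct_primes (σ ⊕ Unit)
  have h : IsNoetherian (CS 𝕜 σ) (Unit → CS 𝕜 σ) := by
    refine ⟨fun N => ?_⟩
    -- With `w = ∅` every exponent counts, so a reduced element of `N` vanishes and the finitely
    -- many divisors generate `N`.
    obtain ⟨s, hsfin, hsN, hs⟩ := exists_finset_division ∅ hp N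
    refine Submodule.fg_def.2 ⟨s, hsfin, le_antisymm (Submodule.span_le.2 hsN) fun f hf => ?_⟩
    obtain ⟨g, hg, hred⟩ := hs f
    have hN : f - g ∈ N := N.sub_mem hf (Submodule.span_le.2 hsN hg)
    have : f - g = 0 := by
      ext k : 2
      ext a
      exact coeff_eq_zero_of_isReduced hp hinj hN hred a k fun i hi => hi.elim
    rwa [sub_eq_zero.1 this]
  exact isNoetherian_of_linearEquiv (LinearEquiv.funUnique Unit (CS 𝕜 σ) (CS 𝕜 σ))

/-- Divide by the ideal `(f)` with `w` the set of all variables. The only exponent outside `w` is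
`0`, and it is a leading exponent of `(f)`. So every reduced vector is zero and the remainder of `1`
vanishes. -/
theorem isUnit_CS_of_constantCoeff_ne_zero [Finite σ] {f : CS 𝕜 σ}
    (hf : constantCoeff (f : MvPowerSeries σ 𝕜) ≠ 0) : IsUnit f := by
  obtain ⟨p, hp, hinj⟩ := exists_distinct_primes (σ ⊕ Unit)
  let N : Submodule (CS 𝕜 σ) (Unit → CS 𝕜 σ) := Submodule.span _ {fun _ => f}
  have hfN : (fun _ => f) ∈ N := Submodule.mem_span_singleton_self _
  obtain ⟨k, a, ha, hoff, -⟩ := exists_leadingExponent (w := Set.univ) hp hinj hfN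
    ⟨0, (), Off.zero _, hf⟩
  obtain ⟨s, -, hsN, hs⟩ := exists_finset_division Set.univ hp N
  obtain ⟨g, hg, hred⟩ := hs fun _ => 1
  have ha0 : a = 0 := Finsupp.ext fun i => hoff i (Set.mem_univ i)
  subst ha0
  have h0 : (fun _ => 1) - g = 0 := by
    ext k : 2
    ext b
    exact hred k 0 ha b (zero_le)
  have h1 : (fun _ => 1) ∈ N := by
    rw [sub_eq_zero.1 h0]
    exact Submodule.span_le.2 hsN hg
  obtain ⟨u, hu⟩ := Submodule.mem_span_singleton.1 h1
  exact IsUnit.of_mul_eq_one_right u (congrFun hu ())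

instance nontrivial_CS : Nontrivial (CS 𝕜 σ) :=
  ⟨0, 1, fun h => zero_ne_one (α := MvPowerSeries σ 𝕜) (congrArg Subtype.val h)⟩

instance isLocalRing_CS [Finite σ] : IsLocalRing (CS 𝕜 σ) := by
  refine IsLocalRing.of_isUnit_or_isUnit_one_sub_self fun f => ?_
  by_cases hf : constantCoeff (f : MvPowerSeries σ 𝕜) = 0
  · refine Or.inr (isUnit_CS_of_constantCoeff_ne_zero ?_)
    simp [hf]
  · exact Or.inl (isUnit_CS_of_constantCoeff_ne_zero hf)

theorem mem_maximalIdeal_CS [Finite σ] {f : CS 𝕜 σ} :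
    f ∈ IsLocalRing.maximalIdeal (CS 𝕜 σ) ↔ constantCoeff (f : MvPowerSeries σ 𝕜) = 0 := by
  rw [IsLocalRing.mem_maximalIdeal, mem_nonunits_iff]
  constructor
  · intro h
    by_contra hf
    exact h (isUnit_CS_of_constantCoeff_ne_zero hf)
  · intro h hu
    have := (hu.map (CS 𝕜 σ).val).map (constantCoeff (σ := σ) (R := 𝕜))
    exact this.ne_zero h

theorem exists_sub_algebraMap_mem_CS [Finite σ] (f : CS 𝕜 σ) :
    ∃ c : 𝕜, f - algebraMap 𝕜 _ c ∈ IsLocalRing.maximalIdeal (CS 𝕜 σ) :=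
  ⟨constantCoeff (f : MvPowerSeries σ 𝕜), mem_maximalIdeal_CS.2 (by
    simp [MvPowerSeries.algebraMap_apply])⟩

/-- The variables, as convergent power series. -/
noncomputable def varCS (i : σ) : CS 𝕜 σ := ⟨X i, hasPolyradius_monomial _ _⟩

/-- Every convergent series is the sum of its part not involving the variables in `w` and of
multiples of the variables in `w`. -/
theorem exists_eq_add_sum_var [Fintype σ] (w : Set σ) (f : CS 𝕜 σ) :
    ∃ (f₀ : CS 𝕜 σ) (q : σ → CS 𝕜 σ), f = f₀ + ∑ i, varCS i * q i ∧ (∀ i ∉ w, q i = 0) ∧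
      (∀ b, coeff b (f₀ : MvPowerSeries σ 𝕜) = coeff b (f : MvPowerSeries σ 𝕜) ∧ Off w b ∨
        coeff b (f₀ : MvPowerSeries σ 𝕜) = 0 ∧ ¬ Off w b) ∧
      ∀ i b, coeff b (q i : MvPowerSeries σ 𝕜) =
        coeff (b + Finsupp.single i 1) (f : MvPowerSeries σ 𝕜) ∨
          coeff b (q i : MvPowerSeries σ 𝕜) = 0 := by
  classical
  have hch : ∀ b : σ →₀ ℕ, ¬ Off w b → ∃ i, i ∈ w ∧ b i ≠ 0 := fun b hb => by
    unfold Off at hb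
    push Not at hb
    exact hb
  let P : σ → (σ →₀ ℕ) → Prop := fun i b => ∃ h : ¬ Off w b, (hch b h).choose = i
  refine ⟨⟨monQuot 0 (Off w) f, monQuot_mem_CS _ _ f.2⟩,
    fun i => ⟨monQuot (Finsupp.single i 1) (P i) f, monQuot_mem_CS _ _ f.2⟩, ?_, ?_, ?_, ?_⟩
  · ext b
    have hP : ∀ i b, P i b → Finsupp.single i 1 ≤ b := by
      rintro i b ⟨h, rfl⟩
      rw [Finsupp.single_le_iff]
      exact Nat.one_le_iff_ne_zero.2 (hch b h).choose_spec.2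
    have hterm : ∀ i, coeff b ((X i : MvPowerSeries σ 𝕜) *
          monQuot (Finsupp.single i 1) (P i) (f : MvPowerSeries σ 𝕜)) =
        if P i b then coeff b (f : MvPowerSeries σ 𝕜) else 0 := by
      intro i
      rw [mul_comm]
      exact (coeff_monQuot_mul_monomial (Finsupp.single i 1) b (P i) (f : MvPowerSeries σ 𝕜)
        (hP i)).trans (by congr)
    unfold varCS
    simp only [AddMemClass.coe_add, AddSubmonoidClass.coe_finsetSum, MulMemClass.coe_mul,
      map_add, map_sum, hterm, coeff_monQuot, add_zero]
    by_cases hb : Off w b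
    · rw [if_pos hb, Finset.sum_eq_zero fun i _ => if_neg fun h => h.1 hb, add_zero]
    · rw [if_neg hb, zero_add, Finset.sum_eq_single (hch b hb).choose, if_pos ⟨hb, rfl⟩]
      · intro i _ hi
        exact if_neg fun h => hi h.2.symm
      · simp
  · intro i hi
    ext b
    change coeff b (monQuot (Finsupp.single i 1) (P i) (f : MvPowerSeries σ 𝕜)) = (0 : 𝕜)
    rw [coeff_monQuot, if_neg]
    rintro ⟨h, h'⟩
    exact hi (h' ▸ (hch _ h).choose_spec.1)
  · intro b
    simp only [coeff_monQuot, add_zero]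
    by_cases hb : Off w b
    · exact Or.inl ⟨if_pos hb, hb⟩
    · exact Or.inr ⟨if_neg hb, hb⟩
  · intro i b
    simp only [coeff_monQuot]
    split_ifs
    · exact Or.inl rfl
    · exact Or.inr rfl

/-- Homomorphisms to Noetherian local algebras are determined by the images of the variables. -/
theorem algHom_CS_ext [Finite σ] {B : Type*} [CommRing B] [Algebra 𝕜 B] [IsLocalRing B]
    [IsNoetherianRing B] {φ ψ : CS 𝕜 σ →ₐ[𝕜] B} (h : ∀ i, φ (varCS i) = ψ (varCS i))
    (hm : ∀ i, φ (varCS i) ∈ IsLocalRing.maximalIdeal B) : φ = ψ := by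
  cases nonempty_fintype σ
  -- Splitting off the constant term writes the difference as `∑ φ(xᵢ) (φ - ψ)(qᵢ)`, which gains one
  -- power of the maximal ideal; Krull's theorem concludes.
  have key : ∀ n f, φ f - ψ f ∈ IsLocalRing.maximalIdeal B ^ n := by
    intro n
    induction n with
    | zero => simp
    | succ n ih =>
      intro f
      obtain ⟨f₀, q, hf, -, h0, -⟩ := exists_eq_add_sum_var Set.univ f
      have hf₀ : f₀ = algebraMap 𝕜 _ (constantCoeff (f₀ : MvPowerSeries σ 𝕜)) := by
        ext b
        change _ = coeff b (algebraMap 𝕜 (MvPowerSeries σ 𝕜) _)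
        rw [MvPowerSeries.algebraMap_apply, Algebra.algebraMap_self, RingHom.id_apply]
        classical
        rw [coeff_C]
        split_ifs with hb
        · rw [hb, coeff_zero_eq_constantCoeff]
        · rcases h0 b with h | h
          · exact absurd (Finsupp.ext fun i => h.2 i trivial) hb
          · exact h.1
      have h1 : φ f - ψ f = ∑ i, φ (varCS i) * (φ (q i) - ψ (q i)) := by
        rw [hf, map_add, map_add, hf₀, AlgHom.commutes, AlgHom.commutes, add_sub_add_left_eq_sub,
          map_sum, map_sum, ← Finset.sum_sub_distrib]
        refine Finset.sum_congr rfl fun i _ => ?_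
        rw [map_mul, map_mul, ← h i, mul_sub]
      rw [h1, pow_succ']
      exact Ideal.sum_mem _ fun i _ => Ideal.mul_mem_mul (hm i) (ih _)
  ext f
  have := Ideal.iInf_pow_eq_bot_of_isLocalRing (IsLocalRing.maximalIdeal B)
    (IsLocalRing.maximalIdeal.isMaximal B).ne_top
  rw [← sub_eq_zero, ← Ideal.mem_bot, ← this, Submodule.mem_iInf]
  exact fun n => key n f

end Submodules
end AnalyticGerm

namespace AnalyticGerm

open scoped ENNReal NNReal
open MvPowerSeries

/-! ### Substitution, and series in two groups of variables. -/

section Substitution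

variable {𝕜 : Type*} [RCLike 𝕜] {σ τ : Type*}

theorem wnorm_subst_le [Finite σ] {g : σ → MvPowerSeries τ 𝕜} (hg : HasSubst g) {r : τ → ℝ≥0}
    {s : σ → ℝ≥0} (hgs : ∀ i, wnorm r (g i) ≤ s i) (f : MvPowerSeries σ 𝕜) :
    wnorm r (subst g f) ≤ wnorm s f := by
  have h1 : ∀ e, ‖coeff e (subst g f)‖ₑ ≤
      ∑' d, ‖coeff d f‖ₑ * ‖coeff e (d.prod fun i n => g i ^ n)‖ₑ := by
    intro e
    rw [coeff_subst hg, ← tsum_eq_finsum (L := .unconditional _) (coeff_subst_finite hg f e)]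
    refine enorm_tsum_le_tsum_enorm.trans (ENNReal.tsum_le_tsum fun d => ?_)
    rw [smul_eq_mul, enorm_mul]
  have h2 : ∀ d : σ →₀ ℕ, wnorm r (d.prod fun i n => g i ^ n) ≤ monWeight s d := by
    intro d
    unfold Finsupp.prod monWeight
    refine (wnorm_prod_le _ _ _).trans (Finset.prod_le_prod' fun i _ => ?_)
    exact (wnorm_pow_le _ _ _).trans (pow_le_pow_left' (hgs i) _)
  calc wnorm r (subst g f)
      ≤ ∑' e, ∑' d, ‖coeff d f‖ₑ * (‖coeff e (d.prod fun i n => g i ^ n)‖ₑ * monWeight r e) := by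
        refine ENNReal.tsum_le_tsum fun e => ?_
        simp_rw [← mul_assoc]
        rw [ENNReal.tsum_mul_right]
        exact mul_le_mul_left (h1 e) _
    _ = ∑' d, ‖coeff d f‖ₑ * wnorm r (d.prod fun i n => g i ^ n) := by
        rw [ENNReal.tsum_comm]
        simp_rw [ENNReal.tsum_mul_left]
        rfl
    _ ≤ wnorm s f := ENNReal.tsum_le_tsum fun d => mul_le_mul_right (h2 d) _

/-- Every monomial of a series without constant term contains a variable, so scaling all radii by
`2⁻¹ ^ n` scales the norm by at most that factor. -/
theorem exists_wnorm_le [Finite σ] [Finite τ] {g : σ → MvPowerSeries τ 𝕜}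
    (hg : ∀ i, g i ∈ CS 𝕜 τ) (hg0 : ∀ i, constantCoeff (g i) = 0) {s : σ → ℝ≥0}
    (hs : ∀ i, 0 < s i) : ∃ r : τ → ℝ≥0, (∀ i, 0 < r i) ∧ ∀ i, wnorm r (g i) ≤ s i := by
  cases nonempty_fintype σ
  have h1 : ∀ i, ∃ r : τ → ℝ≥0, (∀ x, 0 < r x) ∧ wnorm r (g i) ≠ ∞ := hg
  choose ρ hρ hfin using h1
  obtain ⟨r, hr, hrfin⟩ : ∃ r : τ → ℝ≥0, (∀ x, 0 < r x) ∧ ∀ i, wnorm r (g i) ≠ ∞ := by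
    rcases isEmpty_or_nonempty σ with hσ | hσ
    · exact ⟨fun _ => 1, fun _ => one_pos, fun i => isEmptyElim i⟩
    · refine ⟨fun x => Finset.univ.inf' Finset.univ_nonempty fun i => ρ i x,
        fun x => (Finset.lt_inf'_iff _).2 fun i _ => hρ i x,
        fun i => ne_top_of_le_ne_top (hfin i) (wnorm_mono (fun x => ?_) _)⟩
      exact Finset.inf'_le _ (Finset.mem_univ i)
  have h2 : ∀ i, ∀ᶠ n : ℕ in Filter.atTop, ((2⁻¹ : ℝ≥0∞)) ^ n * wnorm r (g i) ≤ s i := by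
    intro i
    have hlim : Filter.Tendsto (fun n => ((2⁻¹ : ℝ≥0∞)) ^ n * wnorm r (g i)) Filter.atTop
        (nhds (0 * wnorm r (g i))) :=
      ENNReal.Tendsto.mul_const (ENNReal.tendsto_pow_atTop_nhds_zero_of_lt_one (by
        exact ENNReal.inv_lt_one.2 (by norm_num))) (Or.inr (hrfin i))
    rw [zero_mul] at hlim
    exact hlim.eventually_le_const (by exact_mod_cast hs i)
  obtain ⟨n, hn⟩ := (Filter.eventually_all.2 h2).exists
  have hs1 : (2⁻¹ : ℝ≥0) ^ n ≤ 1 := pow_le_one₀ zero_le (by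
    rw [inv_le_one₀ (by norm_num)]; norm_num)
  refine ⟨shrink Set.univ (2⁻¹ ^ n) r, shrink_pos (by positivity) hr, fun i => ?_⟩
  refine le_trans ?_ (hn i)
  unfold wnorm
  rw [← ENNReal.tsum_mul_left]
  refine ENNReal.tsum_le_tsum fun a => ?_
  by_cases ha : Off Set.univ a
  · have ha0 : a = 0 := Finsupp.ext fun x => ha x trivial
    subst ha0
    rw [coeff_zero_eq_constantCoeff, hg0]
    simp
  · refine (mul_le_mul_right (monWeight_shrink_of_not_off ha hs1 r) _).trans (le_of_eq ?_)
    push_cast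
    exact mul_left_comm _ _ _

theorem subst_mem_CS [Finite σ] [Finite τ] {g : σ → MvPowerSeries τ 𝕜}
    (hg : ∀ i, g i ∈ CS 𝕜 τ) (hg0 : ∀ i, constantCoeff (g i) = 0) {f : MvPowerSeries σ 𝕜}
    (hf : f ∈ CS 𝕜 σ) : subst g f ∈ CS 𝕜 τ := by
  obtain ⟨s, hs, hf⟩ := hf
  obtain ⟨r, hr, h⟩ := exists_wnorm_le hg hg0 hs
  exact ⟨r, hr, ne_top_of_le_ne_top hf (wnorm_subst_le (hasSubst_of_constantCoeff_zero hg0) h f)⟩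

/-- Substitution of convergent power series without constant term. -/
noncomputable def substCS [Finite σ] [Finite τ] (g : σ → CS 𝕜 τ)
    (hg0 : ∀ i, constantCoeff (g i : MvPowerSeries τ 𝕜) = 0) : CS 𝕜 σ →ₐ[𝕜] CS 𝕜 τ :=
  ((substAlgHom (R := 𝕜) (hasSubst_of_constantCoeff_zero hg0)).comp (CS 𝕜 σ).val).codRestrict
    (CS 𝕜 τ) fun f => by
      rw [AlgHom.comp_apply, coe_substAlgHom]
      exact subst_mem_CS (fun i => (g i).2) hg0 f.2

theorem substCS_var [Finite σ] [Finite τ] (g : σ → CS 𝕜 τ)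
    (hg0 : ∀ i, constantCoeff (g i : MvPowerSeries τ 𝕜) = 0) (i : σ) :
    substCS g hg0 (varCS i) = g i :=
  Subtype.ext (substAlgHom_X (hasSubst_of_constantCoeff_zero hg0) i)

/-- The inclusion of the convergent power series in the variables `σ` into those in `σ ⊕ τ`. -/
noncomputable def inlCS (𝕜 σ τ : Type*) [RCLike 𝕜] [Finite σ] [Finite τ] :
    CS 𝕜 σ →ₐ[𝕜] CS 𝕜 (σ ⊕ τ) :=
  ((rename (R := 𝕜) (Function.Embedding.inl : σ ↪ σ ⊕ τ)).comp (CS 𝕜 σ).val).codRestrict _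
    fun f => by
      change rename _ (f : MvPowerSeries σ 𝕜) ∈ _
      rw [rename_eq_subst]
      exact subst_mem_CS (fun i => hasPolyradius_monomial _ _) (fun i => constantCoeff_X _) f.2

theorem coe_inlCS [Finite σ] [Finite τ] (f : CS 𝕜 σ) :
    (inlCS 𝕜 σ τ f : MvPowerSeries (σ ⊕ τ) 𝕜) =
      rename (Function.Embedding.inl : σ ↪ σ ⊕ τ) (f : MvPowerSeries σ 𝕜) := rfl

theorem inlCS_var [Finite σ] [Finite τ] (i : σ) :
    inlCS 𝕜 σ τ (varCS i) = varCS (Sum.inl i) :=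
  Subtype.ext (rename_X _ i)

open Classical in
theorem coeff_inlCS [Finite σ] [Finite τ] (f : CS 𝕜 σ) (a : σ →₀ ℕ) (b : τ →₀ ℕ) :
    coeff (a.sumElim b) (inlCS 𝕜 σ τ f : MvPowerSeries (σ ⊕ τ) 𝕜) =
      if b = 0 then coeff a (f : MvPowerSeries σ 𝕜) else 0 := by
  rw [coe_inlCS]
  have hemb : ∀ x : σ →₀ ℕ, Finsupp.embDomain (Function.Embedding.inl : σ ↪ σ ⊕ τ) x =
      x.sumElim (0 : τ →₀ ℕ) := by
    intro x
    ext (i | i)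
    · exact Finsupp.embDomain_apply_self _ _ _
    · rw [Finsupp.embDomain_of_notMem_range _ _ _ (by simp)]
      simp
  split_ifs with hb
  · subst hb
    rw [← hemb, coeff_embDomain_rename]
  · refine coeff_rename_eq_zero _ _ ?_
    rintro ⟨x, hx⟩
    rw [← Finsupp.embDomain_eq_mapDomain, hemb] at hx
    apply hb
    ext i
    simpa using (DFunLike.congr_fun hx (Sum.inr i)).symm

theorem monWeight_sumElim (r : σ ⊕ τ → ℝ≥0) (a : σ →₀ ℕ) (b : τ →₀ ℕ) :
    monWeight r (a.sumElim b) = monWeight (r ∘ Sum.inl) a * monWeight (r ∘ Sum.inr) b := by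
  unfold monWeight
  rw [Finsupp.prod_sumElim]
  rfl

/-- The coefficient of the monomial with exponent `b` in the variables `τ`, as a convergent power
series in the variables `σ`. -/
noncomputable def coeffCS (b : τ →₀ ℕ) : CS 𝕜 (σ ⊕ τ) →ₗ[𝕜] CS 𝕜 σ where
  toFun f := ⟨fun a => coeff (a.sumElim b) (f : MvPowerSeries (σ ⊕ τ) 𝕜), by
    obtain ⟨r, hr, hf⟩ := f.2
    refine ⟨r ∘ Sum.inl, fun i => hr _, fun h => hf ?_⟩
    have hinj : Function.Injective fun a : σ →₀ ℕ => a.sumElim b := by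
      intro a a' h
      ext i
      simpa using DFunLike.congr_fun h (Sum.inl i)
    have key : wnorm (𝕜 := 𝕜) (r ∘ Sum.inl)
        (fun a => coeff (a.sumElim b) (f : MvPowerSeries (σ ⊕ τ) 𝕜)) *
          monWeight (r ∘ Sum.inr) b ≤ wnorm r (f : MvPowerSeries (σ ⊕ τ) 𝕜) := by
      unfold wnorm
      rw [← ENNReal.tsum_mul_right]
      refine le_trans (le_of_eq (tsum_congr fun a => ?_))
        (ENNReal.tsum_comp_le_tsum_of_injective hinj _)
      rw [monWeight_sumElim, ← mul_assoc]
      rfl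
    rw [h, ENNReal.top_mul (monWeight_ne_zero (r := r ∘ Sum.inr) (fun i => hr _) b)] at key
    exact top_le_iff.1 key⟩
  map_add' f g := Subtype.ext (MvPowerSeries.ext fun a => map_add (coeff (a.sumElim b)) _ _)
  map_smul' c f := Subtype.ext (MvPowerSeries.ext fun a => map_smul (coeff (a.sumElim b)) c _)

theorem coeff_coeffCS (a : σ →₀ ℕ) (b : τ →₀ ℕ) (f : CS 𝕜 (σ ⊕ τ)) :
    coeff a (coeffCS b f : MvPowerSeries σ 𝕜) =
      coeff (a.sumElim b) (f : MvPowerSeries (σ ⊕ τ) 𝕜) := rfl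

theorem coeffCS_inlCS_mul [Finite σ] [Finite τ] (b : τ →₀ ℕ) (f : CS 𝕜 σ) (g : CS 𝕜 (σ ⊕ τ)) :
    coeffCS b (inlCS 𝕜 σ τ f * g) = f * coeffCS b g := by
  classical
  ext a
  rw [coeff_coeffCS, MulMemClass.coe_mul, MulMemClass.coe_mul, coeff_mul, coeff_mul,
    ← Finsupp.image_sumElim_product_antidiagonal, Finset.sum_image, Finset.sum_product]
  · refine Finset.sum_congr rfl fun p _ => ?_
    rw [Finset.sum_eq_single (0, b)]
    · rw [coeff_inlCS, if_pos rfl, coeff_coeffCS]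
    · rintro ⟨b₁, b₂⟩ hq hne
      rw [Finset.HasAntidiagonal.mem_antidiagonal] at hq
      rw [coeff_inlCS, if_neg, zero_mul]
      rintro rfl
      rw [zero_add] at hq
      exact hne (by rw [← hq])
    · intro h
      simp at h
  · rintro ⟨⟨x, y⟩, z, t⟩ _ ⟨⟨x', y'⟩, z', t'⟩ _ h
    simp only [Prod.mk.injEq] at h ⊢
    have hinj : ∀ {u u' : σ →₀ ℕ} {v v' : τ →₀ ℕ}, u.sumElim v = u'.sumElim v' →
        u = u' ∧ v = v' := by
      intro u u' v v' h
      constructor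
      · ext i
        simpa using DFunLike.congr_fun h (Sum.inl i)
      · ext i
        simpa using DFunLike.congr_fun h (Sum.inr i)
    obtain ⟨h1, h2⟩ := hinj h.1
    obtain ⟨h3, h4⟩ := hinj h.2
    exact ⟨⟨h1, h3⟩, h2, h4⟩

end Substitution
end AnalyticGerm

namespace AnalyticGerm

open MvPowerSeries

/-! ### Reduced vectors over the base and the ideal of their coefficients. -/

section FlatteningData

variable {𝕜 : Type u} [RCLike 𝕜] {σ τ κ : Type} [Finite σ] [Finite τ]

noncomputable instance inlAlgebra : Algebra (CS 𝕜 σ) (CS 𝕜 (σ ⊕ τ)) :=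
  (inlCS 𝕜 σ τ).toRingHom.toAlgebra

noncomputable instance : Module (CS 𝕜 σ) (CS 𝕜 (σ ⊕ τ)) := Algebra.toModule

noncomputable instance : SMul (CS 𝕜 σ) (CS 𝕜 (σ ⊕ τ)) := Algebra.toSMul

noncomputable instance : Module (CS 𝕜 σ) (κ → CS 𝕜 (σ ⊕ τ)) := Pi.module _ _ _

noncomputable instance : SMul (CS 𝕜 σ) (κ → CS 𝕜 (σ ⊕ τ)) := Pi.instSMul

noncomputable instance : Module 𝕜 (κ → CS 𝕜 (σ ⊕ τ)) := Pi.module _ _ _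

noncomputable instance : SMul 𝕜 (κ → CS 𝕜 (σ ⊕ τ)) := Pi.instSMul

theorem algebraMap_eq_inlCS (f : CS 𝕜 σ) :
    algebraMap (CS 𝕜 σ) (CS 𝕜 (σ ⊕ τ)) f = inlCS 𝕜 σ τ f := rfl

instance : IsScalarTower 𝕜 (CS 𝕜 σ) (CS 𝕜 (σ ⊕ τ)) :=
  IsScalarTower.of_algebraMap_eq fun c => ((inlCS 𝕜 σ τ).commutes c).symm

omit [Finite σ] [Finite τ] in
theorem off_range_inl_sumElim {a : σ →₀ ℕ} {b : τ →₀ ℕ} :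
    Off (Set.range Sum.inl) (a.sumElim b) ↔ a = 0 := by
  constructor
  · intro h
    ext i
    simpa using h (Sum.inl i) ⟨i, rfl⟩
  · rintro rfl _ ⟨i, rfl⟩
    simp

omit [Finite σ] [Finite τ] in
theorem exists_eq_sumElim (c : σ ⊕ τ →₀ ℕ) :
    ∃ (a : σ →₀ ℕ) (b : τ →₀ ℕ), c = a.sumElim b :=
  ⟨_, _, (Finsupp.comapDomain_sumElim_comapDomain c).symm⟩

/-- The coefficient of a vector at a monomial in the variables `τ`. -/
noncomputable def vcoeff (b : τ →₀ ℕ) (k : κ) : (κ → CS 𝕜 (σ ⊕ τ)) →ₗ[CS 𝕜 σ] CS 𝕜 σ where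
  toFun f := coeffCS b (f k)
  map_add' f g := by simp
  map_smul' r f := coeffCS_inlCS_mul b r (f k)

theorem vcoeff_apply (b : τ →₀ ℕ) (k : κ) (f : κ → CS 𝕜 (σ ⊕ τ)) :
    vcoeff b k f = coeffCS b (f k) := rfl

variable (p : (σ ⊕ τ) ⊕ κ → ℕ) (N : Submodule (CS 𝕜 (σ ⊕ τ)) (κ → CS 𝕜 (σ ⊕ τ)))

/-- Leading exponents do not involve the variables `σ`, so divisibility by them depends only on the
`τ`-part of a monomial. This makes reducedness a condition linear over the series in `σ`. -/
theorem isReduced_iff_vcoeff {f : κ → CS 𝕜 (σ ⊕ τ)} :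
    IsReduced (Set.range Sum.inl) p N f ↔
      ∀ k, ∀ a ∈ leadingExponents (Set.range Sum.inl) p N k, ∀ b : τ →₀ ℕ,
        a ≤ (0 : σ →₀ ℕ).sumElim b → vcoeff b k f = 0 := by
  have hle : ∀ {k}, ∀ a ∈ leadingExponents (Set.range Sum.inl) p N k,
      ∀ (x y : σ →₀ ℕ) (b : τ →₀ ℕ), a ≤ x.sumElim b → a ≤ y.sumElim b := by
    rintro k a ⟨_, _, hoff, _⟩ x y b h (i | i)
    · rw [hoff (Sum.inl i) ⟨i, rfl⟩]
      exact Nat.zero_le _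
    · simpa using h (Sum.inr i)
  constructor
  · intro h k a ha b hab
    ext x
    exact h k a ha _ (hle a ha _ _ _ hab)
  · intro h k a ha c hac
    obtain ⟨x, b, rfl⟩ := exists_eq_sumElim c
    have := h k a ha b (hle a ha _ _ _ hac)
    rw [← coeff_coeffCS, ← vcoeff_apply, this]
    simp

/-- The reduced vectors, as a module over the series in the variables `σ`. -/
noncomputable def reducedSubmodule : Submodule (CS 𝕜 σ) (κ → CS 𝕜 (σ ⊕ τ)) where
  carrier := {f | IsReduced (Set.range Sum.inl) p N f}
  add_mem' {f g} hf hg := by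
    simp only [Set.mem_ofPred_eq, isReduced_iff_vcoeff] at hf hg ⊢
    intro k a ha b hab
    rw [map_add, hf k a ha b hab, hg k a ha b hab, add_zero]
  zero_mem' := by
    simp only [Set.mem_ofPred_eq, isReduced_iff_vcoeff]
    intro k a ha b hab
    rw [map_zero]
  smul_mem' r f hf := by
    simp only [Set.mem_ofPred_eq, isReduced_iff_vcoeff] at hf ⊢
    intro k a ha b hab
    rw [map_smul, hf k a ha b hab, smul_zero]

/-- The reduced vectors not involving the variables `σ`. -/
noncomputable def reducedFibre : Submodule 𝕜 (κ → CS 𝕜 (σ ⊕ τ)) where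
  carrier := {f | f ∈ reducedSubmodule p N ∧ ∀ k c, ¬ Off (Set.range Sum.inl) c →
    coeff c (f k : MvPowerSeries (σ ⊕ τ) 𝕜) = 0}
  add_mem' {f g} hf hg := ⟨add_mem hf.1 hg.1, fun k c hc => by
    simp [hf.2 k c hc, hg.2 k c hc]⟩
  zero_mem' := ⟨zero_mem _, fun k c hc => by simp⟩
  smul_mem' t f hf := ⟨by
    rw [← algebraMap_smul (CS 𝕜 σ) t f]
    exact Submodule.smul_mem _ _ hf.1, fun k c hc => by
    simp [hf.2 k c hc]⟩

theorem vcoeff_of_mem_reducedFibre {f : κ → CS 𝕜 (σ ⊕ τ)} (hf : f ∈ reducedFibre p N)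
    (b : τ →₀ ℕ) (k : κ) : vcoeff b k f =
      algebraMap 𝕜 (CS 𝕜 σ) (coeff ((0 : σ →₀ ℕ).sumElim b) (f k : MvPowerSeries (σ ⊕ τ) 𝕜)) := by
  classical
  ext a
  change coeff (a.sumElim b) (f k : MvPowerSeries (σ ⊕ τ) 𝕜) =
    coeff a (algebraMap 𝕜 (MvPowerSeries σ 𝕜) _)
  rw [MvPowerSeries.algebraMap_apply, Algebra.algebraMap_self, RingHom.id_apply, coeff_C]
  split_ifs with h
  · rw [h]
  · exact hf.2 k _ fun h' => h (off_range_inl_sumElim.1 h')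

local notation "𝔪" => IsLocalRing.maximalIdeal

theorem varCS_mem_maximalIdeal {ρ : Type*} [Finite ρ] (i : ρ) :
    varCS i ∈ 𝔪 (CS 𝕜 ρ) :=
  mem_maximalIdeal_CS.2 (constantCoeff_X i)

/-- Separate the monomials free of `σ` and divide the others by a variable of `σ`. The quotients
stay reduced: if `a ≤ b`, then `a` also divides the shifted exponent from which the coefficient at
`b` was taken. -/
theorem reducedSubmodule_le_span_sup_smul : reducedSubmodule p N ≤
    Submodule.span (CS 𝕜 σ) (reducedFibre p N : Set (κ → CS 𝕜 (σ ⊕ τ))) ⊔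
      𝔪 (CS 𝕜 σ) • reducedSubmodule p N := by
  cases nonempty_fintype σ
  cases nonempty_fintype τ
  intro f hf
  choose f₀ q hfq hq0 hf₀ hq using fun k => exists_eq_add_sum_var (Set.range Sum.inl) (f k)
  have heq : f = f₀ + ∑ i : σ, (varCS i : CS 𝕜 σ) • fun k => q k (Sum.inl i) := by
    ext k : 1
    rw [hfq k, Fintype.sum_sum_type]
    have h2 : ∑ i : τ, varCS (𝕜 := 𝕜) (Sum.inr i : σ ⊕ τ) * q k (Sum.inr i) = 0 :=
      Finset.sum_eq_zero fun i _ => by rw [hq0 k _ (by simp), mul_zero]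
    rw [h2, add_zero, Pi.add_apply, Finset.sum_apply]
    congr 1
    refine Finset.sum_congr rfl fun i _ => ?_
    rw [Pi.smul_apply, Algebra.smul_def, algebraMap_eq_inlCS, inlCS_var]
  rw [heq]
  refine add_mem (Submodule.mem_sup_left (Submodule.subset_span ⟨?_, ?_⟩))
    (Submodule.mem_sup_right (sum_mem fun i _ => Submodule.smul_mem_smul
      (varCS_mem_maximalIdeal i) ?_))
  · intro k a ha b hab
    rcases hf₀ k b with h | h
    · rw [h.1, hf k a ha b hab]
    · exact h.1
  · intro k c hc
    rcases hf₀ k c with h | h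
    · exact absurd h.2 hc
    · exact h.1
  · intro k a ha b hab
    rcases hq k (Sum.inl i) b with h | h
    · rw [h]
      exact hf k a ha _ (hab.trans le_self_add)
    · exact h

theorem reducedSubmodule_le_span_sup_pow_smul (n : ℕ) : reducedSubmodule p N ≤
    Submodule.span (CS 𝕜 σ) (reducedFibre p N : Set (κ → CS 𝕜 (σ ⊕ τ))) ⊔
      𝔪 (CS 𝕜 σ) ^ n • reducedSubmodule p N := by
  induction n with
  | zero => simp
  | succ n ih =>
    refine (reducedSubmodule_le_span_sup_smul p N).trans (sup_le le_sup_left ?_)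
    refine (Submodule.smul_mono le_rfl ih).trans ?_
    rw [Submodule.smul_sup, ← Submodule.mul_smul, ← pow_succ']
    exact sup_le_sup_right Submodule.smul_le_right _

/-- The ideal generated by the coefficients of the reduced elements of `N`. -/
noncomputable def coeffIdeal : Ideal (CS 𝕜 σ) :=
  Ideal.span {x | ∃ f ∈ N, f ∈ reducedSubmodule p N ∧ ∃ b k, x = vcoeff b k f}

theorem restrictScalars_sup_reducedSubmodule [Finite κ] (hp : ∀ x, (p x).Prime) :
    N.restrictScalars (CS 𝕜 σ) ⊔ reducedSubmodule p N = ⊤ := by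
  obtain ⟨s, -, hsN, hs⟩ := exists_finset_division (Set.range Sum.inl) hp N
  refine eq_top_iff.2 fun f _ => ?_
  obtain ⟨g, hg, hred⟩ := hs f
  rw [← add_sub_cancel g f]
  exact Submodule.add_mem_sup (Submodule.span_le.2 hsN hg) hred

theorem vcoeff_mem_of_mem_smul (𝔠 : Ideal (CS 𝕜 σ)) {L : Submodule (CS 𝕜 σ) (κ → CS 𝕜 (σ ⊕ τ))}
    {f : κ → CS 𝕜 (σ ⊕ τ)} (hf : f ∈ 𝔠 • L) (b : τ →₀ ℕ) (k : κ) : vcoeff b k f ∈ 𝔠 := by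
  refine Submodule.smul_induction_on hf (fun r hr x _ => ?_) fun x y hx hy => ?_
  · rw [map_smul]
    exact 𝔠.mul_mem_right _ hr
  · rw [map_add]
    exact 𝔠.add_mem hx hy

/-- Modulo the variables `σ`, the vectors `v` and `n` coincide. If `v ≠ 0`, then `n` has a monomial
free of `σ` whose exponent is a leading exponent of `N`; it also occurs in `v`, contradicting
reducedness. -/
theorem mem_reducedFibre_eq_zero (hp : ∀ x, (p x).Prime) (hinj : Function.Injective p)
    {v n e : κ → CS 𝕜 (σ ⊕ τ)} (hv : v ∈ reducedFibre p N) (hn : n ∈ N)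
    (he : ∀ b k, vcoeff b k e ∈ 𝔪 (CS 𝕜 σ)) (h : v = n + e) : v = 0 := by
  have hcoeff : ∀ c k, Off (Set.range Sum.inl) c →
      coeff c (v k : MvPowerSeries (σ ⊕ τ) 𝕜) = coeff c (n k : MvPowerSeries (σ ⊕ τ) 𝕜) := by
    intro c k hc
    obtain ⟨a, b, rfl⟩ := exists_eq_sumElim c
    obtain rfl := off_range_inl_sumElim.1 hc
    have h1 := mem_maximalIdeal_CS.1 (he b k)
    rw [← coeff_zero_eq_constantCoeff_apply, vcoeff_apply, coeff_coeffCS] at h1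
    rw [h, Pi.add_apply, AddMemClass.coe_add, map_add, h1, add_zero]
  by_contra hne
  have hex : ∃ c k, Off (Set.range Sum.inl) c ∧
      coeff c (n k : MvPowerSeries (σ ⊕ τ) 𝕜) ≠ 0 := by
    by_contra hall
    push Not at hall
    refine hne ?_
    ext k : 2
    ext c
    by_cases hc : Off (Set.range Sum.inl) c
    · rw [hcoeff c k hc, hall c k hc]
      simp
    · rw [hv.2 k c hc]
      simp
  obtain ⟨k, c, hc, hoff, h0⟩ := exists_leadingExponent hp hinj hn hex
  rw [← hcoeff c k hoff] at h0
  exact h0 (hv.1 k c hc c le_rfl)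

theorem _root_.Ideal.mem_of_forall_dual_eq_zero {K A : Type*} [Field K] [CommRing A] [Algebra K A]
    (I : Ideal A) (x : A) (h : ∀ ℓ : A →ₗ[K] K, (∀ y ∈ I, ℓ y = 0) → ℓ x = 0) : x ∈ I := by
  rw [← Ideal.Quotient.eq_zero_iff_mem, ← Module.forall_dual_apply_eq_zero_iff K]
  intro ℓ
  refine h (ℓ ∘ₗ (Ideal.Quotient.mkₐ K I).toLinearMap) fun y hy => ?_
  change ℓ (Ideal.Quotient.mk I y) = 0
  rw [Ideal.Quotient.eq_zero_iff_mem.2 hy, map_zero]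

/-- The `τ`-coefficients of the `v j` are scalars. A `𝕜`-linear functional vanishing on `𝔠` thus
turns the hypothesis into a scalar relation between the `v j`, which is trivial. Hence every such
functional kills `ρ i`, and linear functionals detect membership in `𝔠`. -/
theorem forall_mem_of_vcoeff_linearCombination_mem {B : Type*} {v : B → reducedFibre p N}
    (hv : Function.Injective (Finsupp.linearCombination 𝕜 v)) (𝔠 : Ideal (CS 𝕜 σ)) (ρ : B →₀ CS 𝕜 σ)
    (h : ∀ b k, vcoeff b k (Finsupp.linearCombination (CS 𝕜 σ)
      (fun i => (v i : κ → CS 𝕜 (σ ⊕ τ))) ρ) ∈ 𝔠) (i : B) : ρ i ∈ 𝔠 := by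
  refine Ideal.mem_of_forall_dual_eq_zero (K := 𝕜) 𝔠 (ρ i) fun ℓ' hℓ => ?_
  let c : B →₀ 𝕜 := ρ.mapRange ℓ' (map_zero _)
  have hc : Finsupp.linearCombination 𝕜 v c = 0 := by
    ext k : 3
    ext d
    have hsum : (Finsupp.linearCombination 𝕜 v c : κ → CS 𝕜 (σ ⊕ τ)) =
        ρ.sum fun j r => ℓ' r • (v j : κ → CS 𝕜 (σ ⊕ τ)) := by
      rw [Finsupp.linearCombination_apply, Finsupp.sum_mapRange_index (by simp), Finsupp.sum,
        Finsupp.sum, AddSubmonoidClass.coe_finsetSum]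
      rfl
    by_cases hd : Off (Set.range Sum.inl) d
    · obtain ⟨a, b, rfl⟩ := exists_eq_sumElim d
      obtain rfl := off_range_inl_sumElim.1 hd
      have h1 := hℓ _ (h b k)
      rw [Finsupp.linearCombination_apply, Finsupp.sum, map_sum, map_sum] at h1
      rw [hsum, Finsupp.sum, Finset.sum_apply, AddSubmonoidClass.coe_finsetSum, map_sum]
      refine Eq.trans (Finset.sum_congr rfl fun j _ => ?_) h1
      rw [map_smul, vcoeff_of_mem_reducedFibre p N (v j).2, smul_eq_mul, mul_comm,
        ← Algebra.smul_def, map_smul, smul_eq_mul, mul_comm]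
      simp
    · have := (Finsupp.linearCombination 𝕜 v c).2.2 k d hd
      rw [this]
      simp
  have hc0 : c = 0 := hv (hc.trans (map_zero _).symm)
  have hci : c i = 0 := by rw [hc0, Finsupp.zero_apply]
  rwa [Finsupp.mapRange_apply] at hci

end FlatteningData

/-! ### The flattening ideal over convergent series. -/

section Exists

variable {𝕜 : Type u} [RCLike 𝕜] {σ τ : Type} [Finite σ] [Finite τ]

local notation "𝔪" => IsLocalRing.maximalIdeal

/-- The coefficient ideal that flattens a finite module `F` over the convergent power series in
`σ ⊕ τ`, relative to the convergent power series in `σ`, together with lifts `v` of a basis of the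
fibre of `F`. -/
theorem exists_flattening_data (F : Type v) [AddCommGroup F] [Module (CS 𝕜 σ) F]
    [Module (CS 𝕜 (σ ⊕ τ)) F] [IsScalarTower (CS 𝕜 σ) (CS 𝕜 (σ ⊕ τ)) F]
    [Module.Finite (CS 𝕜 (σ ⊕ τ)) F] :
    ∃ (B : Type u) (v : B → F) (I : Ideal (CS 𝕜 σ)),
      (∀ n, Submodule.span (CS 𝕜 σ) (Set.range v) ⊔
        (𝔪 (CS 𝕜 σ) ^ n • ⊤ : Submodule (CS 𝕜 σ) F) = ⊤) ∧
      (∀ 𝔠 : Ideal (CS 𝕜 σ), I ≤ 𝔠 → ∀ ρ : B →₀ CS 𝕜 σ,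
        Finsupp.linearCombination (CS 𝕜 σ) v ρ ∈ (𝔠 • ⊤ : Submodule (CS 𝕜 σ) F) →
          ∀ b, ρ b ∈ 𝔠) ∧
      (∀ n, I ≤ 𝔪 (CS 𝕜 σ) ^ n ⊔ Ideal.span {x | ∃ (ρ : B →₀ CS 𝕜 σ) (b : B),
        Finsupp.linearCombination (CS 𝕜 σ) v ρ ∈
          (𝔪 (CS 𝕜 σ) ^ n • ⊤ : Submodule (CS 𝕜 σ) F) ∧ x = ρ b}) ∧
      ∀ c : B →₀ 𝕜, Finsupp.linearCombination (CS 𝕜 σ) v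
        (c.mapRange (algebraMap 𝕜 (CS 𝕜 σ)) (map_zero _)) ∈
          (𝔪 (CS 𝕜 σ) • ⊤ : Submodule (CS 𝕜 σ) F) → c = 0 := by
  obtain ⟨q, π, hπ⟩ := Module.Finite.exists_fin' (CS 𝕜 (σ ⊕ τ)) F
  obtain ⟨p, hp, hinj⟩ := exists_distinct_primes ((σ ⊕ τ) ⊕ Fin q)
  let N := LinearMap.ker π
  let π' : (Fin q → CS 𝕜 (σ ⊕ τ)) →ₗ[CS 𝕜 σ] F := π.restrictScalars (CS 𝕜 σ)
  have hπ' : ∀ f, π' f = 0 → f ∈ N := fun f hf => hf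
  let e := Module.Basis.ofVectorSpace 𝕜 (reducedFibre p N)
  let v₀ : Module.Basis.ofVectorSpaceIndex 𝕜 (reducedFibre p N) → Fin q → CS 𝕜 (σ ⊕ τ) :=
    fun i => (e i : Fin q → CS 𝕜 (σ ⊕ τ))
  have hdiv := restrictScalars_sup_reducedSubmodule p N hp
  have hlc : ∀ ρ, Finsupp.linearCombination (CS 𝕜 σ) (fun i => π' (v₀ i)) ρ =
      π' (Finsupp.linearCombination (CS 𝕜 σ) v₀ ρ) := fun ρ => by
    rw [Finsupp.apply_linearCombination]
    rfl
  have hrange : LinearMap.range π' = ⊤ := LinearMap.range_eq_top.2 hπ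
  have hN : (N.restrictScalars (CS 𝕜 σ)).map π' = ⊥ := by
    rw [eq_bot_iff]
    rintro _ ⟨f, hf, rfl⟩
    exact hf
  have hmap : (reducedSubmodule p N).map π' = ⊤ := by
    rw [← hrange, LinearMap.range_eq_map, ← hdiv, Submodule.map_sup, hN, bot_sup_eq]
  have hspan : Submodule.span (CS 𝕜 σ) (reducedFibre p N : Set (Fin q → CS 𝕜 (σ ⊕ τ))) ≤
      Submodule.span (CS 𝕜 σ) (Set.range v₀) := by
    refine Submodule.span_le.2 fun f hf => ?_
    have h1 := e.linearCombination_repr ⟨f, hf⟩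
    have h2 := congrArg Subtype.val h1
    rw [Finsupp.linearCombination_apply, Finsupp.sum, AddSubmonoidClass.coe_finsetSum] at h2
    change _ = f at h2
    rw [← h2]
    refine sum_mem fun i _ => ?_
    rw [SetLike.val_smul, ← algebraMap_smul (CS 𝕜 σ)]
    exact Submodule.smul_mem _ _ (Submodule.subset_span ⟨i, rfl⟩)
  -- The reduced vectors already surject onto `F`, so an element of `𝔠 F` lifts to `𝔠` times the
  -- reduced vectors.
  have hlift : ∀ (𝔠 : Ideal (CS 𝕜 σ)) (u : Fin q → CS 𝕜 (σ ⊕ τ)),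
      π' u ∈ (𝔠 • ⊤ : Submodule (CS 𝕜 σ) F) →
        ∃ d ∈ 𝔠 • reducedSubmodule p N, u - d ∈ N := by
    intro 𝔠 u hu
    rw [← hmap, ← Submodule.map_smul''] at hu
    obtain ⟨d, hd, hdu⟩ := hu
    exact ⟨d, hd, hπ' _ (by rw [map_sub, hdu, sub_self])⟩
  have hv₀ : ∀ ρ, Finsupp.linearCombination (CS 𝕜 σ) v₀ ρ ∈ reducedSubmodule p N := fun ρ => by
    rw [Finsupp.linearCombination_apply]
    exact sum_mem fun i _ => Submodule.smul_mem _ _ (e i).2.1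
  refine ⟨_, fun i => π' (v₀ i), coeffIdeal p N, fun n => ?_, fun 𝔠 h𝔠 ρ hρ => ?_, fun n => ?_,
    fun c hc => ?_⟩
  · have h1 := Submodule.map_mono (f := π') ((reducedSubmodule_le_span_sup_pow_smul p N n).trans
      (sup_le_sup_right hspan _))
    rw [hmap, Submodule.map_sup, Submodule.map_smul'', hmap, Submodule.map_span,
      ← Set.range_comp] at h1
    exact top_le_iff.1 h1
  -- A relation modulo `𝔠` becomes, after subtracting `d`, a reduced element of `N`. Its
  -- coefficients lie in `coeffIdeal p N ≤ 𝔠`, as do those of `d`.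
  · rw [hlc] at hρ
    obtain ⟨d, hd, hud⟩ := hlift 𝔠 _ hρ
    refine forall_mem_of_vcoeff_linearCombination_mem p N e.linearIndependent 𝔠 ρ fun b k => ?_
    have h1 : vcoeff b k (Finsupp.linearCombination (CS 𝕜 σ) v₀ ρ - d) ∈ 𝔠 :=
      h𝔠 (Ideal.subset_span ⟨_, hud, sub_mem (hv₀ ρ) (Submodule.smul_le_right hd), b, k, rfl⟩)
    rw [map_sub] at h1
    exact (Submodule.sub_mem_iff_left _ (vcoeff_mem_of_mem_smul 𝔠 hd b k)).1 h1
  · refine Ideal.span_le.2 ?_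
    rintro _ ⟨f, hfN, hf, b, k, rfl⟩
    -- A reduced element of `N` is a finite combination of the `v₀ i` up to `d ∈ 𝔪 ^ n L`. Its image
    -- in `F` is zero, so the combination is a relation modulo `𝔪 ^ n`.
    obtain ⟨s, hs, d, hd, rfl⟩ := Submodule.mem_sup.1
      (((reducedSubmodule_le_span_sup_pow_smul p N n).trans (sup_le_sup_right hspan _)) hf)
    obtain ⟨ρ, rfl⟩ := Finsupp.mem_span_range_iff_exists_finsupp.1 hs
    change vcoeff b k (Finsupp.linearCombination (CS 𝕜 σ) v₀ ρ + d) ∈ _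
    change Finsupp.linearCombination (CS 𝕜 σ) v₀ ρ + d ∈ N at hfN
    rw [map_add]
    refine add_mem ?_ (Submodule.mem_sup_left (vcoeff_mem_of_mem_smul _ hd b k))
    have hπd : Finsupp.linearCombination (CS 𝕜 σ) (fun i => π' (v₀ i)) ρ ∈
        (𝔪 (CS 𝕜 σ) ^ n • ⊤ : Submodule (CS 𝕜 σ) F) := by
      have h0 : π' (Finsupp.linearCombination (CS 𝕜 σ) v₀ ρ) + π' d = 0 := by
        rw [← map_add]
        exact hfN
      rw [hlc, eq_neg_of_add_eq_zero_left h0, ← hmap, ← Submodule.map_smul'']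
      exact neg_mem (Submodule.mem_map_of_mem hd)
    refine Submodule.mem_sup_right ?_
    rw [Finsupp.linearCombination_apply, Finsupp.sum, map_sum]
    refine sum_mem fun i _ => ?_
    rw [map_smul]
    exact Ideal.mul_mem_right _ _ (Ideal.subset_span ⟨ρ, i, hπd, rfl⟩)
  · rw [hlc] at hc
    obtain ⟨d, hd, hud⟩ := hlift _ _ hc
    have hval : Finsupp.linearCombination (CS 𝕜 σ) v₀
        (c.mapRange (algebraMap 𝕜 (CS 𝕜 σ)) (map_zero _)) =
          (Finsupp.linearCombination 𝕜 e c : Fin q → CS 𝕜 (σ ⊕ τ)) := by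
      rw [Finsupp.linearCombination_apply, Finsupp.sum_mapRange_index (by simp),
        Finsupp.linearCombination_apply, Finsupp.sum, Finsupp.sum,
        AddSubmonoidClass.coe_finsetSum]
      refine Finset.sum_congr rfl fun i _ => ?_
      rw [algebraMap_smul]
      rfl
    rw [hval] at hud
    have h0 := mem_reducedFibre_eq_zero p N hp hinj (Finsupp.linearCombination 𝕜 e c).2 hud
      (fun b k => vcoeff_mem_of_mem_smul _ hd b k) (sub_add_cancel _ _).symm
    exact e.linearIndependent ((Subtype.ext h0).trans (map_zero _).symm)

end Exists
end AnalyticGerm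

namespace AnalyticGerm

/-! ### Flatness and bases modulo powers of the maximal ideal. -/

section Flatness

local notation "𝔪" => IsLocalRing.maximalIdeal

theorem mem_map_smul_top_iff {R A M : Type*} [CommRing R] [CommRing A] [Algebra R A]
    [AddCommGroup M] [Module R M] [Module A M] [IsScalarTower R A M] (J : Ideal R)
    (x : M) :
    x ∈ (J.map (algebraMap R A) • ⊤ : Submodule A M) ↔ x ∈ (J • ⊤ : Submodule R M) := by
  have h := Ideal.smul_restrictScalars (R := R) (S := A) J (⊤ : Submodule A M)
  rw [Submodule.restrictScalars_top] at h
  rw [← h, Submodule.restrictScalars_mem]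

/-- A form of the local criterion of flatness: `M` is flat if it has a family `v` that becomes a
basis modulo all powers of the maximal ideal. -/
theorem flat_of_forall_basis_mod_pow {R B M ι : Type*} [CommRing R] [IsLocalRing R]
    [IsNoetherianRing R] [CommRing B] [IsLocalRing B] [IsNoetherianRing B] [Algebra R B]
    (hRB : (𝔪 R).map (algebraMap R B) ≤ 𝔪 B) [AddCommGroup M] [Module R M] [Module B M]
    [IsScalarTower R B M] [Module.Finite B M] (v : ι → M)
    (hspan : ∀ n, Submodule.span R (Set.range v) ⊔ (𝔪 R ^ n • ⊤ : Submodule R M) = ⊤)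
    (hind : ∀ n (ρ : ι →₀ R),
      Finsupp.linearCombination R v ρ ∈ (𝔪 R ^ n • ⊤ : Submodule R M) → ∀ b, ρ b ∈ 𝔪 R ^ n) :
    Module.Flat R M := by
  classical
  rw [Module.Flat.iff_lTensor_injective']
  intro J
  rw [injective_iff_map_eq_zero]
  intro x hx
  have hfin : Module.Finite B (M ⊗[R] J) :=
    Module.Finite.equiv (TensorProduct.AlgebraTensorModule.cancelBaseChange R B B M J)
  -- `M ⊗ J` is finite over the Noetherian local ring `B`, though perhaps not over `R`, so Krull's
  -- intersection theorem is applied over `B`.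
  suffices h : ∀ n, x ∈ (𝔪 R ^ n • ⊤ : Submodule R (M ⊗[R] J)) by
    have hkrull := Ideal.iInf_pow_smul_eq_bot_of_isLocalRing (M := M ⊗[R] J)
      ((𝔪 R).map (algebraMap R B))
      (fun h => (IsLocalRing.maximalIdeal.isMaximal B).ne_top (top_le_iff.1 (h ▸ hRB)))
    rw [← Submodule.mem_bot B, ← hkrull, Submodule.mem_iInf]
    intro n
    rw [← Ideal.map_pow]
    exact (mem_map_smul_top_iff _ _).2 (h n)
  intro n
  -- The Artin–Rees constant `k`: working modulo `𝔪 ^ (n + k)` makes coefficients in `J ∩ 𝔪 ^ (n +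
  -- k)` land in `𝔪 ^ n J`.
  obtain ⟨k, hk⟩ := Ideal.exists_pow_inf_eq_pow_smul (𝔪 R) (J : Submodule R R)
  have hAR : ∀ a : J, (a : R) ∈ 𝔪 R ^ (n + k) → a ∈ (𝔪 R ^ n • ⊤ : Submodule R J) := by
    intro a ha
    have h1 : (a : R) ∈ (𝔪 R ^ (n + k) • ⊤ : Submodule R R) ⊓ J :=
      ⟨by simpa using ha, a.2⟩
    rw [hk (n + k) (Nat.le_add_left _ _), Nat.add_sub_cancel] at h1
    have h2 : (a : R) ∈ 𝔪 R ^ n • (J : Submodule R R) :=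
      Submodule.smul_mono le_rfl inf_le_right h1
    have h3 : (𝔪 R ^ n • ⊤ : Submodule R J).map J.subtype = 𝔪 R ^ n • (J : Submodule R R) := by
      rw [Submodule.map_smul'', Submodule.map_top, Submodule.range_subtype]
    rw [← h3] at h2
    obtain ⟨a', ha', haa⟩ := h2
    rwa [← Subtype.ext haa]
  have hdecomp : ∀ y : M ⊗[R] J, ∃ α : ι →₀ J,
      y - α.sum (fun b a => v b ⊗ₜ[R] a) ∈ (𝔪 R ^ (n + k) • ⊤ : Submodule R (M ⊗[R] J)) := by
    intro y
    induction y using TensorProduct.induction_on with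
    | zero => exact ⟨0, by simp⟩
    | tmul m a =>
      obtain ⟨s, hs, d, hd, rfl⟩ := Submodule.mem_sup.1
        ((hspan (n + k)).symm ▸ Submodule.mem_top : m ∈ _)
      obtain ⟨ρ, rfl⟩ := Finsupp.mem_span_range_iff_exists_finsupp.1 hs
      refine ⟨ρ.mapRange (fun r => r • a) (zero_smul _ _), ?_⟩
      rw [Finsupp.sum_mapRange_index (by simp), TensorProduct.add_tmul, Finsupp.sum, Finsupp.sum,
        TensorProduct.sum_tmul]
      simp_rw [TensorProduct.smul_tmul]
      rw [add_sub_cancel_left]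
      have := Submodule.mem_map_of_mem (f := (TensorProduct.mk R M J).flip a) hd
      rw [Submodule.map_smul''] at this
      exact Submodule.smul_mono le_rfl le_top this
    | add y z hy hz =>
      obtain ⟨α, hα⟩ := hy
      obtain ⟨β, hβ⟩ := hz
      refine ⟨α + β, ?_⟩
      rw [Finsupp.sum_add_index' (by simp) (by simp [TensorProduct.tmul_add])]
      convert add_mem hα hβ using 1
      abel
  obtain ⟨α, hα⟩ := hdecomp x
  let θ : M ⊗[R] J →ₗ[R] M := (TensorProduct.rid R M).toLinearMap ∘ₗ J.subtype.lTensor M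
  have hθx : θ x = 0 := by
    change TensorProduct.rid R M (J.subtype.lTensor M x) = 0
    rw [hx, map_zero]
  have hθα : Finsupp.linearCombination R v (α.mapRange (fun a : J => (a : R)) rfl) ∈
      (𝔪 R ^ (n + k) • ⊤ : Submodule R M) := by
    have h1 := Submodule.mem_map_of_mem (f := θ) hα
    rw [Submodule.map_smul'', map_sub, hθx, zero_sub] at h1
    have h2 := neg_mem (Submodule.smul_mono le_rfl (le_top (a := Submodule.map θ ⊤)) h1)
    rw [neg_neg, Finsupp.sum, map_sum] at h2
    rw [Finsupp.linearCombination_apply, Finsupp.sum_mapRange_index (by simp), Finsupp.sum]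
    convert h2 using 1
    refine Finset.sum_congr rfl fun b _ => ?_
    simp [θ]
  have hα' := hind _ _ hθα
  rw [← sub_add_cancel x (α.sum fun b a => v b ⊗ₜ[R] a)]
  refine add_mem (Submodule.smul_mono (Ideal.pow_le_pow_right (Nat.le_add_right n k)) le_rfl hα)
    (sum_mem fun b _ => ?_)
  have h4 := Submodule.mem_map_of_mem (f := TensorProduct.mk R M J (v b)) (hAR (α b) (hα' b))
  rw [Submodule.map_smul''] at h4
  exact Submodule.smul_mono le_rfl le_top h4

/-- The hypothesis is independence in the fibre over the residue field, which lifts to a flat module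
over a local ring. -/
theorem eq_zero_of_linearCombination_eq_zero {R : Type u} {M : Type v} {ι : Type u} [CommRing R]
    [IsLocalRing R] [AddCommGroup M] [Module R M] [Module.Flat R M] (v : ι → M)
    (hv : ∀ ρ : ι →₀ R, Finsupp.linearCombination R v ρ ∈ (𝔪 R • ⊤ : Submodule R M) →
      ∀ b, ρ b ∈ 𝔪 R) (ρ : ι →₀ R) (hρ : Finsupp.linearCombination R v ρ = 0) : ρ = 0 := by
  refine linearIndependent_iff.1 (Module.IsLocalRing.linearIndependent_of_flat v ?_) ρ hρ
  rw [linearIndependent_iff]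
  intro l hl
  obtain ⟨r, rfl⟩ := Finsupp.mapRange_surjective (IsLocalRing.residue R) (map_zero _)
    IsLocalRing.residue_surjective l
  have h1 : TensorProduct.mk R (IsLocalRing.ResidueField R) M 1
      (Finsupp.linearCombination R v r) = 0 := by
    rw [← hl, Finsupp.linearCombination_apply, Finsupp.linearCombination_apply,
      Finsupp.sum_mapRange_index (by simp), Finsupp.sum, Finsupp.sum, map_sum]
    refine Finset.sum_congr rfl fun b _ => ?_
    rw [map_smul]
    exact (algebraMap_smul (IsLocalRing.ResidueField R) (r b) _).symm
  have h2 := hv r (by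
    rw [← LinearMap.ker_tensorProductMk]
    exact h1)
  ext b
  rw [Finsupp.mapRange_apply, Finsupp.zero_apply, IsLocalRing.residue_eq_zero_iff]
  exact h2 b

/-- In a flat module over a local ring, a family that is independent modulo the maximal ideal is
independent modulo every ideal. -/
theorem coeff_mem_of_linearCombination_mem {R : Type u} {M : Type v} {ι : Type u} [CommRing R]
    [IsLocalRing R] [AddCommGroup M] [Module R M] [Module.Flat R M] (v : ι → M)
    (hv : ∀ ρ : ι →₀ R, Finsupp.linearCombination R v ρ ∈ (𝔪 R • ⊤ : Submodule R M) →
      ∀ b, ρ b ∈ 𝔪 R) (J : Ideal R) (ρ : ι →₀ R)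
    (hρ : Finsupp.linearCombination R v ρ ∈ (J • ⊤ : Submodule R M)) (b : ι) : ρ b ∈ J := by
  by_cases hJ : J = ⊤
  · rw [hJ]
    trivial
  have : Nontrivial (R ⧸ J) := Ideal.Quotient.nontrivial_iff.2 hJ
  have : IsLocalRing (R ⧸ J) :=
    IsLocalRing.of_surjective' (Ideal.Quotient.mk J) Ideal.Quotient.mk_surjective
  -- Flatness passes to `M / JM` over `R / J`, where a relation modulo `J` becomes an exact
  -- relation; independence in the closed fibre is unchanged because `J ≤ 𝔪`.
  have hflat : Module.Flat (R ⧸ J) (M ⧸ (J • ⊤ : Submodule R M)) :=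
    Module.Flat.of_linearEquiv
      ((TensorProduct.quotTensorEquivQuotSMul M J).symm.extendScalarsOfSurjective
        (S := R ⧸ J) Ideal.Quotient.mk_surjective)
  let v' : ι → M ⧸ (J • ⊤ : Submodule R M) := fun b => Submodule.Quotient.mk (v b)
  have hlc : ∀ r : ι →₀ R, Finsupp.linearCombination (R ⧸ J) v'
      (r.mapRange (Ideal.Quotient.mk J) (map_zero _)) =
        Submodule.Quotient.mk (Finsupp.linearCombination R v r) := by
    intro r
    rw [Finsupp.linearCombination_apply, Finsupp.linearCombination_apply,
      Finsupp.sum_mapRange_index (by simp), Finsupp.sum, Finsupp.sum, ← Submodule.mkQ_apply,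
      map_sum]
    rfl
  have h0 := eq_zero_of_linearCombination_eq_zero v' (fun l hl b => ?_)
    (ρ.mapRange (Ideal.Quotient.mk J) (map_zero _)) (by
      rw [hlc]
      exact (Submodule.Quotient.mk_eq_zero _).2 hρ)
  · have := DFunLike.congr_fun h0 b
    rwa [Finsupp.mapRange_apply, Finsupp.zero_apply, Ideal.Quotient.eq_zero_iff_mem] at this
  · have hmap : 𝔪 (R ⧸ J) = (𝔪 R).map (Ideal.Quotient.mk J) :=
      ((IsLocalRing.map_maximalIdeal_of_surjective _ Ideal.Quotient.mk_surjective)).symm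
    obtain ⟨r, rfl⟩ := Finsupp.mapRange_surjective (Ideal.Quotient.mk J) (map_zero _)
      Ideal.Quotient.mk_surjective l
    rw [hlc] at hl
    rw [Finsupp.mapRange_apply, hmap]
    refine Ideal.mem_map_of_mem _ (hv r ?_ b)
    have hJm : (J • ⊤ : Submodule R M) ≤ 𝔪 R • ⊤ :=
      Submodule.smul_mono (IsLocalRing.le_maximalIdeal hJ) le_rfl
    suffices h : ∀ y : M ⧸ (J • ⊤ : Submodule R M),
        y ∈ (𝔪 (R ⧸ J) • ⊤ : Submodule (R ⧸ J) (M ⧸ (J • ⊤ : Submodule R M))) →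
          y ∈ (𝔪 R • ⊤ : Submodule R M).map (Submodule.mkQ _) by
      obtain ⟨z, hz, hzy⟩ := h _ hl
      have h3 := hJm ((Submodule.Quotient.eq _).1 hzy)
      exact (Submodule.sub_mem_iff_right _ hz).1 h3
    intro y hy
    refine Submodule.smul_induction_on hy (fun t ht z _ => ?_) fun _ _ => add_mem
    rw [hmap, Ideal.mem_map_iff_of_surjective _ Ideal.Quotient.mk_surjective] at ht
    obtain ⟨t, ht, rfl⟩ := ht
    obtain ⟨z, rfl⟩ := Submodule.Quotient.mk_surjective _ z
    exact ⟨t • z, Submodule.smul_mem_smul ht trivial, rfl⟩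

end Flatness
end AnalyticGerm

namespace AnalyticGerm

open MvPowerSeries

local notation "𝔪" => IsLocalRing.maximalIdeal

/-! ### Local analytic algebras and presentations of morphisms. -/

section LocalAnalytic

variable {𝕜 : Type u} [RCLike 𝕜] {A B : Type u} [CommRing A] [Algebra 𝕜 A] [CommRing B]
  [Algebra 𝕜 B]

theorem IsLocalAnalyticAlgebra.exists_surjective_CS (hA : IsLocalAnalyticAlgebra 𝕜 A) :
    ∃ (n : ℕ) (π : CS 𝕜 (Fin n) →ₐ[𝕜] A), Function.Surjective π := by
  obtain ⟨n, π, hπ⟩ := hA.exists_surjective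
  exact ⟨n, π.comp (Subalgebra.equivOfEq _ _ (convSeries_eq 𝕜 n)).symm.toAlgHom,
    hπ.comp (Subalgebra.equivOfEq _ _ (convSeries_eq 𝕜 n)).symm.surjective⟩

theorem IsLocalAnalyticAlgebra.isNoetherianRing (hA : IsLocalAnalyticAlgebra 𝕜 A) :
    IsNoetherianRing A := by
  obtain ⟨n, π, hπ⟩ := hA.exists_surjective_CS
  exact isNoetherianRing_of_surjective _ _ π.toRingHom hπ

theorem IsLocalAnalyticAlgebra.isLocalRing (hA : IsLocalAnalyticAlgebra 𝕜 A) : IsLocalRing A := by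
  obtain ⟨n, π, hπ⟩ := hA.exists_surjective_CS
  have := hA.nontrivial
  exact IsLocalRing.of_surjective' π.toRingHom hπ

theorem IsLocalAnalyticAlgebra.exists_sub_algebraMap_mem (hA : IsLocalAnalyticAlgebra 𝕜 A)
    [IsLocalRing A] (x : A) : ∃ c : 𝕜, x - algebraMap 𝕜 A c ∈ 𝔪 A := by
  obtain ⟨n, π, hπ⟩ := hA.exists_surjective_CS
  obtain ⟨f, rfl⟩ := hπ x
  obtain ⟨c, hc⟩ := exists_sub_algebraMap_mem_CS f
  refine ⟨c, ?_⟩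
  have hmap := IsLocalRing.map_maximalIdeal_of_surjective π.toRingHom hπ
  rw [← hmap]
  have := Ideal.mem_map_of_mem π.toRingHom hc
  rw [map_sub] at this
  have hcomm : π.toRingHom (algebraMap 𝕜 _ c) = algebraMap 𝕜 A c := π.commutes c
  rwa [hcomm] at this

theorem IsLocalAnalyticAlgebra.of_surjective (hA : IsLocalAnalyticAlgebra 𝕜 A) [Nontrivial B]
    (f : A →ₐ[𝕜] B) (hf : Function.Surjective f) : IsLocalAnalyticAlgebra 𝕜 B := by
  obtain ⟨n, π, hπ⟩ := hA.exists_surjective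
  exact ⟨inferInstance, n, f.comp π, hf.comp hπ⟩

/-- If `f x` had a nonzero value `c` at the closed point, `x - c` would be a unit while its image `f
x - c` is not. -/
theorem map_mem_maximalIdeal {K A B : Type*} [Field K] [CommRing A] [Algebra K A] [CommRing B]
    [Algebra K B] [IsLocalRing A] [IsLocalRing B]
    (hB : ∀ y : B, ∃ c : K, y - algebraMap K B c ∈ 𝔪 B) (f : A →ₐ[K] B) {x : A} (hx : x ∈ 𝔪 A) :
    f x ∈ 𝔪 B := by
  obtain ⟨c, hc⟩ := hB (f x)
  by_cases h0 : c = 0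
  · simpa [h0] using hc
  · have hu : IsUnit (x - algebraMap K A c) := by
      by_contra h
      have h1 := Ideal.sub_mem _ hx ((IsLocalRing.mem_maximalIdeal _).2 h)
      rw [sub_sub_cancel] at h1
      exact (IsLocalRing.mem_maximalIdeal _).1 h1 ((IsUnit.mk0 c h0).map (algebraMap K A))
    have := hu.map f
    rw [map_sub, AlgHom.commutes] at this
    exact absurd this ((IsLocalRing.mem_maximalIdeal _).1 hc)

theorem eq_zero_of_algebraMap_mem_maximalIdeal {K A : Type*} [Field K] [CommRing A] [Algebra K A]
    [IsLocalRing A] {c : K} (hc : algebraMap K A c ∈ 𝔪 A) : c = 0 := by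
  by_contra h
  exact (IsLocalRing.mem_maximalIdeal _).1 hc ((IsUnit.mk0 c h).map (algebraMap K A))

/-- The evaluation of a local algebra with residue field `K` at its closed point. -/
theorem exists_augmentation {K A : Type*} [Field K] [CommRing A] [Algebra K A] [IsLocalRing A]
    (hA : ∀ y : A, ∃ c : K, y - algebraMap K A c ∈ 𝔪 A) :
    ∃ ε : A →ₐ[K] K, ∀ x ∈ 𝔪 A, ε x = 0 := by
  have hbij : Function.Bijective (Algebra.ofId K (IsLocalRing.ResidueField A)) := by
    refine ⟨(Algebra.ofId K (IsLocalRing.ResidueField A)).toRingHom.injective, fun y => ?_⟩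
    obtain ⟨x, rfl⟩ := IsLocalRing.residue_surjective y
    obtain ⟨c, hc⟩ := hA x
    refine ⟨c, ?_⟩
    rw [← IsLocalRing.residue_eq_zero_iff, map_sub, sub_eq_zero] at hc
    exact hc.symm
  refine ⟨(AlgEquiv.ofBijective _ hbij).symm.toAlgHom.comp
    (IsScalarTower.toAlgHom K A (IsLocalRing.ResidueField A)), fun x hx => ?_⟩
  have h0 : algebraMap A (IsLocalRing.ResidueField A) x = 0 :=
    (IsLocalRing.residue_eq_zero_iff x).2 hx
  change (AlgEquiv.ofBijective _ hbij).symm (algebraMap A (IsLocalRing.ResidueField A) x) = 0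
  rw [h0, map_zero]

/-- A morphism of germs factors as a closed embedding into a product followed by the projection. -/
theorem exists_presentation {OW OZ : Type u} [CommRing OW] [Algebra 𝕜 OW] [CommRing OZ]
    [Algebra 𝕜 OZ] (hW : IsLocalAnalyticAlgebra 𝕜 OW) (hZ : IsLocalAnalyticAlgebra 𝕜 OZ)
    (φ : OW →ₐ[𝕜] OZ) {m : ℕ} (π : CS 𝕜 (Fin m) →ₐ[𝕜] OW) :
    ∃ (k : ℕ) (Φ : CS 𝕜 (Fin m ⊕ Fin k) →ₐ[𝕜] OZ), Function.Surjective Φ ∧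
      ∀ f, Φ (inlCS 𝕜 (Fin m) (Fin k) f) = φ (π f) := by
  have := hW.isLocalRing
  have := hZ.isLocalRing
  have := hZ.isNoetherianRing
  obtain ⟨k, πZ, hπZ⟩ := hZ.exists_surjective_CS
  have hloc : ∀ i, φ (π (varCS i)) ∈ 𝔪 OZ := fun i =>
    map_mem_maximalIdeal hZ.exists_sub_algebraMap_mem (φ.comp π) (varCS_mem_maximalIdeal i)
  choose g hg using fun i => hπZ (φ (π (varCS i)))
  have hg0 : ∀ i, constantCoeff (g i : MvPowerSeries (Fin k) 𝕜) = 0 := fun i => by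
    rw [← mem_maximalIdeal_CS, IsLocalRing.mem_maximalIdeal, mem_nonunits_iff]
    intro hu
    have h1 := hloc i
    rw [← hg i] at h1
    exact (IsLocalRing.mem_maximalIdeal _).1 h1 (hu.map πZ)
  -- The graph of the morphism: the base coordinates are substituted by lifts of their images in
  -- `OZ`, the remaining ones by themselves.
  let G : Fin m ⊕ Fin k → CS 𝕜 (Fin k) := Sum.elim g varCS
  have hG0 : ∀ i, constantCoeff (G i : MvPowerSeries (Fin k) 𝕜) = 0 := by
    rintro (i | i)
    · exact hg0 i
    · exact constantCoeff_X i
  refine ⟨k, πZ.comp (substCS G hG0), ?_, fun f => ?_⟩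
  · refine hπZ.comp fun f => ?_
    let H : Fin k → CS 𝕜 (Fin m ⊕ Fin k) := fun i => varCS (Sum.inr i)
    have hH0 : ∀ i, constantCoeff (H i : MvPowerSeries (Fin m ⊕ Fin k) 𝕜) = 0 :=
      fun i => constantCoeff_X _
    refine ⟨substCS H hH0 f, ?_⟩
    have heq : (substCS G hG0).comp (substCS H hH0) = AlgHom.id 𝕜 _ := by
      refine algHom_CS_ext (fun i => ?_) fun i => ?_
      · rw [AlgHom.comp_apply, substCS_var, substCS_var, AlgHom.id_apply]
        rfl
      · rw [AlgHom.comp_apply, substCS_var, substCS_var]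
        exact varCS_mem_maximalIdeal i
    exact DFunLike.congr_fun heq f
  · have heq : (πZ.comp (substCS G hG0)).comp (inlCS 𝕜 (Fin m) (Fin k)) = φ.comp π := by
      have hvar : ∀ i, ((πZ.comp (substCS G hG0)).comp (inlCS 𝕜 (Fin m) (Fin k))) (varCS i) =
          φ (π (varCS i)) := fun i => by
        rw [AlgHom.comp_apply, inlCS_var, AlgHom.comp_apply, substCS_var]
        exact hg i
      refine algHom_CS_ext hvar fun i => ?_
      rw [hvar]
      exact hloc i
    exact DFunLike.congr_fun heq f

end LocalAnalytic

/-! ### Linear combinations under change of rings. -/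

section Transfer

variable {R A M ι : Type*} [CommRing R] [CommRing A] [Algebra R A] [AddCommGroup M] [Module R M]
  [Module A M] [IsScalarTower R A M]

theorem linearCombination_mapRange_algebraMap (v : ι → M) (ρ : ι →₀ R) :
    Finsupp.linearCombination A v (ρ.mapRange (algebraMap R A) (map_zero _)) =
      Finsupp.linearCombination R v ρ := by
  rw [Finsupp.linearCombination_apply, Finsupp.linearCombination_apply,
    Finsupp.sum_mapRange_index (by simp)]
  simp_rw [algebraMap_smul]

theorem span_sup_smul_top_eq_top (v : ι → M) (J : Ideal R)
    (h : Submodule.span R (Set.range v) ⊔ (J • ⊤ : Submodule R M) = ⊤) :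
    Submodule.span A (Set.range v) ⊔ (J.map (algebraMap R A) • ⊤ : Submodule A M) = ⊤ := by
  refine eq_top_iff.2 fun x _ => ?_
  obtain ⟨y, hy, z, hz, rfl⟩ := Submodule.mem_sup.1 (h.symm ▸ Submodule.mem_top : x ∈ _)
  exact Submodule.add_mem_sup (Submodule.span_le_restrictScalars R A _ hy)
    ((mem_map_smul_top_iff J z).2 hz)

/-- Independence over the residue field implies independence modulo the maximal ideal. -/
theorem coeff_mem_maximalIdeal_of_fibre {K : Type*} [Field K] [Algebra K A] [IsLocalRing A]
    (hA : ∀ y : A, ∃ c : K, y - algebraMap K A c ∈ 𝔪 A) (v : ι → M)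
    (hv : ∀ c : ι →₀ K, Finsupp.linearCombination A v
      (c.mapRange (algebraMap K A) (map_zero _)) ∈ (𝔪 A • ⊤ : Submodule A M) → c = 0)
    (ρ : ι →₀ A) (hρ : Finsupp.linearCombination A v ρ ∈ (𝔪 A • ⊤ : Submodule A M)) (b : ι) :
    ρ b ∈ 𝔪 A := by
  classical
  choose s hs using hA
  have hs0 : s 0 = 0 := by
    have := hs 0
    rw [zero_sub, neg_mem_iff] at this
    exact eq_zero_of_algebraMap_mem_maximalIdeal this
  -- Replacing each coefficient by its value at the closed point changes the combination only by an
  -- element of `𝔪 M`.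
  let c : ι →₀ K := ρ.mapRange s hs0
  have hc : c = 0 := by
    refine hv c ?_
    have hdiff : Finsupp.linearCombination A v
        (ρ - c.mapRange (algebraMap K A) (map_zero _)) ∈ (𝔪 A • ⊤ : Submodule A M) := by
      rw [Finsupp.linearCombination_apply]
      refine sum_mem fun i _ => Submodule.smul_mem_smul ?_ trivial
      exact hs (ρ i)
    rw [map_sub] at hdiff
    exact (Submodule.sub_mem_iff_right _ hρ).1 hdiff
  have h1 := hs (ρ b)
  have h2 : s (ρ b) = 0 := DFunLike.congr_fun hc b
  rwa [h2, map_zero, sub_zero] at h1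

end Transfer
end AnalyticGerm

namespace AnalyticGerm

local notation "𝔪" => IsLocalRing.maximalIdeal

/-! ### Flattening families: descent to quotients and flatness modulo `I`. -/

section FlatteningFamily

/-- A family `v` in `F` that spans `F` modulo all powers of the maximal ideal, is a basis of the
closed fibre, and whose relations have coefficients generating `I`, up to powers of the maximal
ideal, while it has no relations modulo ideals containing `I` but the trivial ones. -/
structure IsFlatteningFamily (K : Type*) {A F ι : Type*} [Field K] [CommRing A] [Algebra K A]
    [IsLocalRing A] [AddCommGroup F] [Module A F] (v : ι → F) (I : Ideal A) : Prop where
  span_sup_eq_top : ∀ n, Submodule.span A (Set.range v) ⊔ (𝔪 A ^ n • ⊤ : Submodule A F) = ⊤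
  coeff_mem : ∀ J : Ideal A, I ≤ J → ∀ ρ : ι →₀ A,
    Finsupp.linearCombination A v ρ ∈ (J • ⊤ : Submodule A F) → ∀ b, ρ b ∈ J
  le_sup_span : ∀ n, I ≤ 𝔪 A ^ n ⊔ Ideal.span {x | ∃ (ρ : ι →₀ A) (b : ι),
    Finsupp.linearCombination A v ρ ∈ (𝔪 A ^ n • ⊤ : Submodule A F) ∧ x = ρ b}
  eq_zero_of_mem : ∀ c : ι →₀ K,
    Finsupp.linearCombination A v (c.mapRange (algebraMap K A) (map_zero _)) ∈
      (𝔪 A • ⊤ : Submodule A F) → c = 0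

variable {K R A F ι : Type*} [Field K] [CommRing R] [CommRing A] [Algebra K R] [Algebra K A]
  [Algebra R A] [IsScalarTower K R A] [IsLocalRing R] [IsLocalRing A] [AddCommGroup F] [Module R F]
  [Module A F] [IsScalarTower R A F]

/-- This passes from the ambient convergent series to `OW`: ideals of `A` are images of ideals of
`R`, coefficients lift, and the maximal ideals correspond. -/
theorem IsFlatteningFamily.map_of_surjective (hs : Function.Surjective (algebraMap R A))
    {v : ι → F} {I : Ideal R} (h : IsFlatteningFamily K v I) :
    IsFlatteningFamily K v (I.map (algebraMap R A)) := by
  have hm : (𝔪 R).map (algebraMap R A) = 𝔪 A := IsLocalRing.map_maximalIdeal_of_surjective _ hs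
  have hpow : ∀ n, 𝔪 A ^ n = (𝔪 R ^ n).map (algebraMap R A) := fun n => by rw [Ideal.map_pow, hm]
  constructor
  · intro n
    rw [hpow]
    exact span_sup_smul_top_eq_top v _ (h.span_sup_eq_top n)
  · intro J hJ ρ hρ b
    obtain ⟨ρ, rfl⟩ := Finsupp.mapRange_surjective (algebraMap R A) (map_zero _) hs ρ
    rw [linearCombination_mapRange_algebraMap, ← Ideal.map_comap_of_surjective _ hs J,
      mem_map_smul_top_iff] at hρ
    exact h.coeff_mem _ (Ideal.map_le_iff_le_comap.1 hJ) ρ hρ b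
  · intro n
    refine (Ideal.map_mono (h.le_sup_span n)).trans ?_
    rw [Ideal.map_sup, ← hpow, Ideal.map_span]
    refine sup_le_sup_left (Ideal.span_mono ?_) _
    rintro _ ⟨_, ⟨ρ, b, hρ, rfl⟩, rfl⟩
    refine ⟨ρ.mapRange (algebraMap R A) (map_zero _), b, ?_, (Finsupp.mapRange_apply ..).symm⟩
    rwa [linearCombination_mapRange_algebraMap, hpow, mem_map_smul_top_iff]
  · intro c hc
    refine h.eq_zero_of_mem c ?_
    rw [← linearCombination_mapRange_algebraMap (A := A), ← mem_map_smul_top_iff (A := A), hm]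
    convert hc using 2
    ext b
    simp [← IsScalarTower.algebraMap_apply]


theorem IsFlatteningFamily.le_maximalIdeal {v : ι → F} {I : Ideal A}
    (h : IsFlatteningFamily K v I) (hA : ∀ y : A, ∃ c : K, y - algebraMap K A c ∈ 𝔪 A) :
    I ≤ 𝔪 A := by
  refine (h.le_sup_span 1).trans ?_
  rw [pow_one, sup_le_iff, Ideal.span_le]
  refine ⟨le_rfl, ?_⟩
  rintro _ ⟨ρ, b, hρ, rfl⟩
  exact coeff_mem_maximalIdeal_of_fibre (M := F) hA v h.eq_zero_of_mem ρ hρ b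

/-- Over the subgerm defined by `I`, the restriction of `F` is flat. -/
theorem IsFlatteningFamily.flat {C M : Type*} [IsNoetherianRing A] {v : ι → F} {I : Ideal A}
    (h : IsFlatteningFamily K v I) [IsLocalRing (A ⧸ I)] [CommRing C] [IsLocalRing C]
    [IsNoetherianRing C] [AddCommGroup M] [Module (A ⧸ I) M] [Module C M] [Module.Finite C M]
    (f : A ⧸ I →+* C) (hf : (𝔪 (A ⧸ I)).map f ≤ 𝔪 C) (hfM : ∀ (r : A ⧸ I) (y : M), r • y = f r • y)
    (j₀ : F →+ M) (hjA : ∀ (a : A) (x : F), j₀ (a • x) = Ideal.Quotient.mk I a • j₀ x)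
    (hj : Function.Surjective j₀) (hker : ∀ x, j₀ x = 0 → x ∈ (I • ⊤ : Submodule A F)) :
    Module.Flat (A ⧸ I) M := by
  let : Algebra (A ⧸ I) C := f.toAlgebra
  have : IsScalarTower (A ⧸ I) C M := ⟨fun r d x => by
    rw [Algebra.smul_def, mul_smul, hfM]
    rfl⟩
  let : Module A M := Module.compHom M (Ideal.Quotient.mk I)
  have : IsScalarTower A (A ⧸ I) M := ⟨fun a r x => by
    rw [Algebra.smul_def, mul_smul]
    rfl⟩
  let j : F →ₗ[A] M := { j₀ with map_smul' := hjA }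
  replace hj : Function.Surjective j := hj
  replace hker : ∀ x, j x = 0 → x ∈ (I • ⊤ : Submodule A F) := hker
  have hs : Function.Surjective (algebraMap A (A ⧸ I)) := Ideal.Quotient.mk_surjective
  have hm : (𝔪 A).map (algebraMap A (A ⧸ I)) = 𝔪 (A ⧸ I) :=
    IsLocalRing.map_maximalIdeal_of_surjective _ hs
  have hpow : ∀ n, 𝔪 (A ⧸ I) ^ n = (𝔪 A ^ n).map (algebraMap A (A ⧸ I)) := fun n => by
    rw [Ideal.map_pow, hm]
  have hmap : ∀ J : Ideal A, (J • ⊤ : Submodule A F).map j = J • ⊤ := fun J => by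
    rw [Submodule.map_smul'', Submodule.map_top, LinearMap.range_eq_top.2 hj]
  refine flat_of_forall_basis_mod_pow hf (fun b => j (v b)) (fun n => ?_) fun n ρ hρ b => ?_
  · rw [hpow]
    refine span_sup_smul_top_eq_top _ _ ?_
    rw [← hmap, show (Set.range fun b => j (v b)) = j '' Set.range v from Set.range_comp j v,
      ← Submodule.map_span, ← Submodule.map_sup, h.span_sup_eq_top, Submodule.map_top,
      LinearMap.range_eq_top.2 hj]
  · obtain ⟨ρ, rfl⟩ := Finsupp.mapRange_surjective (algebraMap A (A ⧸ I)) (map_zero _) hs ρ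
    rw [linearCombination_mapRange_algebraMap, hpow, mem_map_smul_top_iff, ← hmap] at hρ
    obtain ⟨y, hy, hyx⟩ := hρ
    have h1 : Finsupp.linearCombination A v ρ - y ∈ (I • ⊤ : Submodule A F) := by
      refine hker _ ?_
      rw [map_sub, hyx, Finsupp.apply_linearCombination, sub_eq_zero]
      rfl
    -- Lifted to `A`, a relation modulo `𝔪 ^ n` over `A ⧸ I` is a relation modulo `𝔪 ^ n ⊔ I`, an
    -- ideal containing `I`, so `coeff_mem` applies.
    have h2 : Finsupp.linearCombination A v ρ ∈ ((𝔪 A ^ n ⊔ I) • ⊤ : Submodule A F) := by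
      rw [← sub_add_cancel (Finsupp.linearCombination A v ρ) y, Submodule.sup_smul, add_comm]
      exact Submodule.add_mem_sup hy h1
    have h3 := Ideal.mem_map_of_mem (algebraMap A (A ⧸ I)) (h.coeff_mem _ le_sup_right ρ h2 b)
    rw [Ideal.map_sup, show I.map (algebraMap A (A ⧸ I)) = ⊥ from Ideal.map_quotient_self I,
      sup_bot_eq] at h3
    rwa [Finsupp.mapRange_apply, hpow]

end FlatteningFamily

/-! ### Base change of flattening families. -/

section BaseChange

/-- Generators of the kernel of `F → D ⊗ F` when `D` is a quotient. -/
theorem mem_smul_top_of_one_tmul_eq_zero {Z D F : Type*} [CommRing Z] [CommRing D] [Algebra Z D]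
    [AddCommGroup F] [Module Z F] (hs : Function.Surjective (algebraMap Z D)) {J : Ideal Z}
    (hJ : RingHom.ker (algebraMap Z D) ≤ J) {x : F} (hx : (1 : D) ⊗ₜ[Z] x = 0) :
    x ∈ (J • ⊤ : Submodule Z F) := by
  let e := Ideal.quotientKerAlgEquivOfSurjective (f := Algebra.ofId Z D) hs
  have h1 : TensorProduct.mk Z (Z ⧸ RingHom.ker (Algebra.ofId Z D)) F 1 x = 0 := by
    have h2 := congrArg (e.symm.toLinearMap.rTensor F) hx
    rw [LinearMap.rTensor_tmul, map_zero] at h2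
    rw [TensorProduct.mk_apply, ← h2]
    congr 1
    exact (map_one e.symm).symm
  have h3 := LinearMap.mem_ker.2 h1
  rw [LinearMap.ker_tensorProductMk] at h3
  exact Submodule.smul_mono hJ le_rfl h3

variable {K A Z D F ι : Type*} [Field K] [CommRing A] [CommRing Z] [CommRing D] [Algebra K A]
  [Algebra A Z] [Algebra Z D] [IsLocalRing A] [AddCommGroup F] [Module A F] [Module Z F]
  [IsScalarTower A Z F]

theorem IsFlatteningFamily.flat_tensorProduct [IsNoetherianRing A] [IsLocalRing D]
    [IsNoetherianRing D] [Module.Finite Z F] {v : ι → F} {I : Ideal A}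
    (h : IsFlatteningFamily K v I) [IsLocalRing (A ⧸ I)] (hs : Function.Surjective (algebraMap Z D))
    (hker : RingHom.ker (algebraMap Z D) ≤ I.map (algebraMap A Z)) (ιT : A ⧸ I →+* D)
    (hD : (𝔪 (A ⧸ I)).map ιT ≤ 𝔪 D)
    (hι : ∀ a, ιT (Ideal.Quotient.mk I a) = algebraMap Z D (algebraMap A Z a)) :
    letI := Module.compHom (D ⊗[Z] F) ιT
    Module.Flat (A ⧸ I) (D ⊗[Z] F) := by
  let := Module.compHom (D ⊗[Z] F) ιT
  refine h.flat (C := D) ιT hD (fun _ _ => rfl)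
    (TensorProduct.mk Z D F 1).toAddMonoidHom (fun a x => ?_) (fun y => ?_) fun x hx => ?_
  · change 1 ⊗ₜ (a • x) = ιT (Ideal.Quotient.mk I a) • ((1 : D) ⊗ₜ[Z] x)
    rw [hι, algebraMap_smul, ← TensorProduct.tmul_smul, algebraMap_smul]
  · exact TensorProduct.mk_surjective Z F D hs y
  · exact (mem_map_smul_top_iff I x).1 (mem_smul_top_of_one_tmul_eq_zero hs hker hx)

/-- If the base change of `F` along `lam` is flat, then `lam` vanishes on `I`. -/
theorem IsFlatteningFamily.map_eq_zero_of_flat {K A Z : Type*} {D T ι : Type u} {F : Type v}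
    [Field K] [CommRing A] [CommRing Z]
    [CommRing D] [Algebra K A] [Algebra K Z] [Algebra A Z] [IsScalarTower K A Z] [Algebra Z D]
    [IsLocalRing A] [AddCommGroup F] [Module A F] [Module Z F] [IsScalarTower A Z F] [CommRing T]
    [IsLocalRing T] [IsNoetherianRing T] [Algebra K T]
    (hT : ∀ y : T, ∃ c : K, y - algebraMap K T c ∈ 𝔪 T) {v : ι → F} {I : Ideal A}
    (h : IsFlatteningFamily K v I) (lam : A →+* T) (hlam : ∀ a ∈ 𝔪 A, lam a ∈ 𝔪 T) (ιT : T →+* D)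
    (hι : ∀ a, ιT (lam a) = algebraMap Z D (algebraMap A Z a))
    (g : D →+* Z ⧸ (𝔪 A).map (algebraMap A Z))
    (hgZ : ∀ z, g (algebraMap Z D z) = Ideal.Quotient.mk _ z)
    (hgT : ∀ t ∈ 𝔪 T, g (ιT t) = 0)
    (hgK : ∀ c : K, g (ιT (algebraMap K T c)) = Ideal.Quotient.mk _ (algebraMap K Z c))
    (hflat : letI := Module.compHom (D ⊗[Z] F) ιT
      Module.Flat T (D ⊗[Z] F)) {a : A} (ha : a ∈ I) : lam a = 0 := by
  let := Module.compHom (D ⊗[Z] F) ιT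
  have hsmul : ∀ (t : T) (y : D ⊗[Z] F), t • y = ιT t • y := fun _ _ => rfl
  let w : ι → D ⊗[Z] F := fun b => 1 ⊗ₜ v b
  let g' : D →ₗ[Z] Z ⧸ (𝔪 A).map (algebraMap A Z) :=
    { toFun := g
      map_add' := map_add g
      map_smul' := fun z d => by
        rw [RingHom.id_apply, Algebra.smul_def, map_mul, hgZ, Algebra.smul_def]
        rfl }
  have hg'smul : ∀ (t : T) (c : K), g (ιT t) = Ideal.Quotient.mk _ (algebraMap K Z c) →
      ∀ y : D ⊗[Z] F, g'.rTensor F (t • y) = algebraMap K Z c • g'.rTensor F y := by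
    intro t c htc y
    induction y using TensorProduct.induction_on with
    | zero => simp
    | add y z hy hz => rw [smul_add, map_add, hy, hz, map_add, smul_add]
    | tmul d x =>
      rw [hsmul, TensorProduct.smul_tmul', LinearMap.rTensor_tmul, LinearMap.rTensor_tmul,
        TensorProduct.smul_tmul']
      congr 1
      change g (ιT t * d) = algebraMap K Z c • g d
      rw [map_mul, htc, Algebra.smul_def]
      rfl
  -- The map `g` sends `D ⊗ F` to the closed fibre of `F` and kills `𝔪 T`, so independence of `v` in
  -- that fibre passes to the elements `1 ⊗ v b`.
  have hfibre : ∀ c : ι →₀ K, Finsupp.linearCombination T w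
      (c.mapRange (algebraMap K T) (map_zero _)) ∈ (𝔪 T • ⊤ : Submodule T (D ⊗[Z] F)) →
        c = 0 := by
    intro c hc
    have hzero : ∀ y ∈ (𝔪 T • ⊤ : Submodule T (D ⊗[Z] F)), g'.rTensor F y = 0 := by
      intro y hy
      refine Submodule.smul_induction_on hy (fun t ht z _ => ?_) fun y z hy hz => ?_
      · rw [hg'smul t 0 (by rw [hgT t ht, map_zero, map_zero]), map_zero, zero_smul]
      · rw [map_add, hy, hz, add_zero]
    have h1 := hzero _ hc
    refine h.eq_zero_of_mem c ((mem_map_smul_top_iff (A := Z) _ _).1 ?_)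
    rw [← LinearMap.ker_tensorProductMk, LinearMap.mem_ker, ← h1]
    rw [Finsupp.linearCombination_apply, Finsupp.linearCombination_apply,
      Finsupp.sum_mapRange_index (by simp), Finsupp.sum_mapRange_index (by simp), Finsupp.sum,
      Finsupp.sum, map_sum, map_sum]
    refine Finset.sum_congr rfl fun b _ => ?_
    rw [hg'smul _ _ (hgK (c b)), ← algebraMap_smul Z (algebraMap K A (c b)) (v b),
      ← IsScalarTower.algebraMap_apply, map_smul, LinearMap.rTensor_tmul]
    congr 1
    change (1 : Z ⧸ (𝔪 A).map (algebraMap A Z)) ⊗ₜ[Z] v b = g 1 ⊗ₜ v b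
    rw [map_one]
  have hind := coeff_mem_maximalIdeal_of_fibre hT w hfibre
  have hpow : ∀ n, (𝔪 A ^ n).map lam ≤ 𝔪 T ^ n := fun n => by
    rw [Ideal.map_pow]
    exact Ideal.pow_right_mono (Ideal.map_le_iff_le_comap.2 hlam) n
  have htmul : ∀ (a : A) (x : F), lam a • ((1 : D) ⊗ₜ[Z] x) = 1 ⊗ₜ (a • x) := fun a x => by
    rw [hsmul, hι, algebraMap_smul, ← TensorProduct.tmul_smul, algebraMap_smul]
  -- Relations between the `v b` modulo `𝔪 A ^ n` go to relations modulo `𝔪 T ^ n`. By flatness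
  -- their coefficients lie in `𝔪 T ^ n`, and these coefficients generate `I` up to `𝔪 A ^ n`.
  have hmem : ∀ n, lam a ∈ 𝔪 T ^ n := by
    intro n
    suffices hle : I ≤ (𝔪 T ^ n).comap lam from hle ha
    refine (h.le_sup_span n).trans (sup_le (Ideal.map_le_iff_le_comap.1 (hpow n)) ?_)
    rw [Ideal.span_le]
    rintro _ ⟨ρ, b, hρ, rfl⟩
    have hlc : Finsupp.linearCombination T w (ρ.mapRange lam (map_zero _)) =
        1 ⊗ₜ Finsupp.linearCombination A v ρ := by
      rw [Finsupp.linearCombination_apply, Finsupp.linearCombination_apply,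
        Finsupp.sum_mapRange_index (by simp), Finsupp.sum, Finsupp.sum, TensorProduct.tmul_sum]
      exact Finset.sum_congr rfl fun b _ => htmul _ _
    have h2 := coeff_mem_of_linearCombination_mem w hind (𝔪 T ^ n) (ρ.mapRange lam (map_zero _))
      (by
        rw [hlc]
        refine Submodule.smul_induction_on hρ (fun a ha x _ => ?_) fun y z hy hz => ?_
        · rw [← htmul]
          exact Submodule.smul_mem_smul (hpow n (Ideal.mem_map_of_mem lam ha)) trivial
        · rw [TensorProduct.tmul_add]
          exact add_mem hy hz) b
    rwa [Finsupp.mapRange_apply] at h2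
  rw [← Ideal.mem_bot, ← Ideal.iInf_pow_eq_bot_of_isLocalRing (𝔪 T)
    (IsLocalRing.maximalIdeal.isMaximal T).ne_top, Ideal.mem_iInf]
  exact hmem

end BaseChange
end AnalyticGerm

namespace AnalyticGerm

local notation "𝔪" => IsLocalRing.maximalIdeal

/-! ### The flattener of a morphism of germs. -/

section LocalFlattener

variable {𝕜 : Type u} [RCLike 𝕜] {OW OZ : Type u} [CommRing OW] [Algebra 𝕜 OW] [CommRing OZ]
  [Algebra 𝕜 OZ]

theorem exists_isFlatteningFamily [IsLocalRing OW] (hW : IsLocalAnalyticAlgebra 𝕜 OW)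
    (hZ : IsLocalAnalyticAlgebra 𝕜 OZ) (φ : OW →ₐ[𝕜] OZ) (F : Type v) [AddCommGroup F] [Module OZ F]
    [Module.Finite OZ F] [Module OW F] (hφ : ∀ (w : OW) (x : F), w • x = φ w • x) :
    ∃ (B : Type u) (v : B → F) (I : Ideal OW), IsFlatteningFamily 𝕜 v I := by
  obtain ⟨m, π, hπ⟩ := hW.exists_surjective_CS
  obtain ⟨k, Φ, hΦ, hcomp⟩ := exists_presentation hW hZ φ π
  let : Algebra (CS 𝕜 (Fin m)) OW := π.toRingHom.toAlgebra
  let : Algebra (CS 𝕜 (Fin m ⊕ Fin k)) OZ := Φ.toRingHom.toAlgebra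
  let : Module (CS 𝕜 (Fin m)) F := Module.compHom F π.toRingHom
  let : Module (CS 𝕜 (Fin m ⊕ Fin k)) F := Module.compHom F Φ.toRingHom
  have : IsScalarTower 𝕜 (CS 𝕜 (Fin m)) OW := IsScalarTower.of_algebraMap_eq fun c =>
    (π.commutes c).symm
  have : IsScalarTower (CS 𝕜 (Fin m)) OW F := ⟨fun r w x => by
    rw [Algebra.smul_def, mul_smul]
    rfl⟩
  have : IsScalarTower (CS 𝕜 (Fin m ⊕ Fin k)) OZ F := ⟨fun r w x => by
    rw [Algebra.smul_def, mul_smul]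
    rfl⟩
  have : IsScalarTower (CS 𝕜 (Fin m)) (CS 𝕜 (Fin m ⊕ Fin k)) F := ⟨fun r s x => by
    rw [Algebra.smul_def, mul_smul]
    change Φ (inlCS 𝕜 (Fin m) (Fin k) r) • (s • x) = π r • (s • x)
    rw [hcomp, hφ]⟩
  have : Module.Finite (CS 𝕜 (Fin m ⊕ Fin k)) OZ :=
    Module.Finite.of_surjective (Algebra.linearMap (CS 𝕜 (Fin m ⊕ Fin k)) OZ) hΦ
  have : Module.Finite (CS 𝕜 (Fin m ⊕ Fin k)) F := Module.Finite.trans OZ F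
  obtain ⟨B, v, I, h1, h2, h3, h4⟩ := exists_flattening_data (𝕜 := 𝕜) (σ := Fin m) (τ := Fin k) F
  have h : IsFlatteningFamily 𝕜 v I := ⟨h1, h2, h3, h4⟩
  exact ⟨B, v, _, h.map_of_surjective (A := OW) hπ⟩

/-- A pair of maps agreeing on `OW` must kill the extension of `I` to `OZ`, and quotients of local
analytic algebras are again local analytic when nonzero. -/
theorem isAnalyticTensorProduct_quotient (hZ : IsLocalAnalyticAlgebra 𝕜 OZ) (φ : OW →ₐ[𝕜] OZ)
    (I : Ideal OW) (hI : I.map φ ≠ ⊤) :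
    IsAnalyticTensorProduct φ (Ideal.Quotient.mkₐ 𝕜 I) (Ideal.Quotient.mkₐ 𝕜 (I.map φ))
      (Ideal.quotientMapₐ (I.map φ) φ Ideal.le_comap_map) := by
  have := Ideal.Quotient.nontrivial_iff.2 hI
  refine ⟨hZ.of_surjective (Ideal.Quotient.mkₐ 𝕜 _) Ideal.Quotient.mk_surjective, ?_, ?_⟩
  · ext x
    rfl
  · intro E _ _ _ f g hfg
    have hf : ∀ a ∈ I.map φ, f a = 0 := fun a ha => by
      suffices h : I.map φ ≤ RingHom.ker f from h ha
      refine Ideal.map_le_iff_le_comap.2 fun w hw => ?_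
      have h1 := DFunLike.congr_fun hfg w
      change f (φ w) = 0
      change f (φ w) = g (Ideal.Quotient.mk I w) at h1
      rw [h1, Ideal.Quotient.eq_zero_iff_mem.2 hw, map_zero]
    refine ⟨Ideal.Quotient.liftₐ _ f hf, ⟨?_, ?_⟩, ?_⟩
    · ext x
      rfl
    · refine Ideal.Quotient.algHom_ext _ ?_
      rw [← hfg]
      ext x
      rfl
    · rintro h ⟨rfl, -⟩
      refine Ideal.Quotient.algHom_ext _ ?_
      ext x
      rfl

variable {F : Type v} [AddCommGroup F] [Module OZ F] [Module OW F]

theorem IsFlatteningFamily.flatAfterBaseChange [IsLocalRing OW]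
    (hW : IsLocalAnalyticAlgebra 𝕜 OW) (hZ : IsLocalAnalyticAlgebra 𝕜 OZ) (φ : OW →ₐ[𝕜] OZ)
    [Module.Finite OZ F] (hφ : ∀ (w : OW) (x : F), w • x = φ w • x) {B : Type u} {v : B → F}
    {I : Ideal OW} (h : IsFlatteningFamily 𝕜 v I) :
    FlatAfterBaseChange φ F (Ideal.Quotient.mkₐ 𝕜 I) := by
  have := hZ.isLocalRing
  have hIW := h.le_maximalIdeal hW.exists_sub_algebraMap_mem
  have hI : I.map φ ≠ ⊤ := fun htop => by
    have hle : I.map φ ≤ 𝔪 OZ := Ideal.map_le_iff_le_comap.2 fun w hw =>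
      map_mem_maximalIdeal hZ.exists_sub_algebraMap_mem φ (hIW hw)
    exact (IsLocalRing.maximalIdeal.isMaximal OZ).ne_top (top_le_iff.1 (htop ▸ hle))
  have hten := isAnalyticTensorProduct_quotient hZ φ I hI
  refine ⟨OZ ⧸ I.map φ, inferInstance, inferInstance, _, _, hten, ?_⟩
  have := Ideal.Quotient.nontrivial_iff.2
    (ne_top_of_le_ne_top (IsLocalRing.maximalIdeal.isMaximal OW).ne_top hIW)
  have := hW.isNoetherianRing
  have := hten.analytic.isLocalRing
  have := hten.analytic.isNoetherianRing
  have : IsLocalRing (OW ⧸ I) :=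
    IsLocalRing.of_surjective' (Ideal.Quotient.mk I) Ideal.Quotient.mk_surjective
  let : Algebra OW OZ := φ.toRingHom.toAlgebra
  have : IsScalarTower OW OZ F := ⟨fun w z x => by
    rw [Algebra.smul_def, mul_smul, hφ]
    rfl⟩
  let : Algebra OZ (OZ ⧸ I.map φ) := (Ideal.Quotient.mkₐ 𝕜 (I.map φ)).toRingHom.toAlgebra
  refine h.flat_tensorProduct (Z := OZ) (D := OZ ⧸ I.map φ) Ideal.Quotient.mk_surjective
    Ideal.mk_ker.le (Ideal.quotientMapₐ (I.map φ) φ Ideal.le_comap_map).toRingHom ?_ fun _ => rfl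
  exact Ideal.map_le_iff_le_comap.2 fun x hx =>
    map_mem_maximalIdeal hten.analytic.exists_sub_algebraMap_mem _ hx

theorem IsFlatteningFamily.map_eq_zero_of_flatAfterBaseChange [IsLocalRing OW]
    (hW : IsLocalAnalyticAlgebra 𝕜 OW) (hZ : IsLocalAnalyticAlgebra 𝕜 OZ) (φ : OW →ₐ[𝕜] OZ)
    (hφ : ∀ (w : OW) (x : F), w • x = φ w • x) {B : Type u} {v : B → F}
    {I : Ideal OW} (h : IsFlatteningFamily 𝕜 v I) {OT : Type u} [CommRing OT] [Algebra 𝕜 OT]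
    (hT : IsLocalAnalyticAlgebra 𝕜 OT) (lam : OW →ₐ[𝕜] OT) (hflat : FlatAfterBaseChange φ F lam)
    {a : OW} (ha : a ∈ I) : lam a = 0 := by
  have := hT.isLocalRing
  have := hT.isNoetherianRing
  have := hZ.isLocalRing
  obtain ⟨D, _, _, ιZ, ιT, hten, hflat⟩ := hflat
  have hlam : ∀ w ∈ 𝔪 OW, lam w ∈ 𝔪 OT := fun w hw =>
    map_mem_maximalIdeal hT.exists_sub_algebraMap_mem lam hw
  obtain ⟨ε, hε⟩ := exists_augmentation hT.exists_sub_algebraMap_mem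
  let : Algebra OW OZ := φ.toRingHom.toAlgebra
  have : IsScalarTower OW OZ F := ⟨fun w z x => by
    rw [Algebra.smul_def, mul_smul, hφ]
    rfl⟩
  have : IsScalarTower 𝕜 OW OZ := IsScalarTower.of_algebraMap_eq fun c => (φ.commutes c).symm
  let E := OZ ⧸ (𝔪 OW).map (algebraMap OW OZ)
  have hE : IsLocalAnalyticAlgebra 𝕜 E := by
    have : Nontrivial E := Ideal.Quotient.nontrivial_iff.2 fun htop => by
      have hle : (𝔪 OW).map (algebraMap OW OZ) ≤ 𝔪 OZ := Ideal.map_le_iff_le_comap.2 fun w hw =>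
        map_mem_maximalIdeal hZ.exists_sub_algebraMap_mem φ hw
      exact (IsLocalRing.maximalIdeal.isMaximal OZ).ne_top (top_le_iff.1 (htop ▸ hle))
    exact hZ.of_surjective (Ideal.Quotient.mkₐ 𝕜 _) Ideal.Quotient.mk_surjective
  let f : OZ →ₐ[𝕜] E := Ideal.Quotient.mkₐ 𝕜 _
  -- The closed fibre `E` receives `OZ` by projection and `OT` through its closed point. The
  -- universal property then gives `D → E`, whichever model `D` was chosen.
  let g₀ : OT →ₐ[𝕜] E := (Algebra.ofId 𝕜 E).comp ε
  have hfg : f.comp φ = g₀.comp lam := by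
    ext w
    obtain ⟨c, hc⟩ := hW.exists_sub_algebraMap_mem w
    have h1 : f (φ (w - algebraMap 𝕜 OW c)) = 0 :=
      Ideal.Quotient.eq_zero_iff_mem.2 (Ideal.mem_map_of_mem (algebraMap OW OZ) hc)
    have h2 : g₀ (lam (w - algebraMap 𝕜 OW c)) = 0 := by
      rw [AlgHom.comp_apply, hε _ (hlam _ hc), map_zero]
    rw [map_sub, map_sub, AlgHom.commutes, AlgHom.commutes, sub_eq_zero] at h1 h2
    exact h1.trans h2.symm
  obtain ⟨g, ⟨hgZ, hgT⟩, -⟩ := hten.existsUnique_lift E hE f g₀ hfg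
  let : Algebra OZ D := ιZ.toRingHom.toAlgebra
  refine h.map_eq_zero_of_flat (Z := OZ) (D := D) hT.exists_sub_algebraMap_mem lam.toRingHom hlam
    ιT.toRingHom (fun w => (DFunLike.congr_fun hten.comm w).symm) g.toRingHom
    (fun z => DFunLike.congr_fun hgZ z) (fun t ht => ?_) (fun c => ?_) hflat ha
  · refine (DFunLike.congr_fun hgT t).trans ?_
    rw [AlgHom.comp_apply, hε t ht, map_zero]
  · exact (DFunLike.congr_fun hgT _).trans (g₀.commutes c)

end LocalFlattener

end AnalyticGerm
/-- Morphisms of germs are written as homomorphisms of their local rings: `φ : OW → OZ` is the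
morphism `Z → W`, the subgerm `P` of `W` is given by the ideal `I` with `OP = OW ⧸ I`, and
`Ideal.Quotient.mkₐ 𝕜 I : OW → OP` is the embedding `P → W`. -/
theorem theorem2p1 {𝕜 : Type u} [RCLike 𝕜]
    {OW OZ : Type u} [CommRing OW] [Algebra 𝕜 OW] [CommRing OZ] [Algebra 𝕜 OZ]
    (hW : AnalyticGerm.IsLocalAnalyticAlgebra 𝕜 OW) [IsRegularLocalRing OW]
    (hZ : AnalyticGerm.IsLocalAnalyticAlgebra 𝕜 OZ)
    (φ : OW →ₐ[𝕜] OZ)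
    (F : Type v) [AddCommGroup F] [Module OZ F] [Module.Finite OZ F] :
    ∃! I : Ideal OW,
      AnalyticGerm.IsLocalAnalyticAlgebra 𝕜 (OW ⧸ I) ∧
      AnalyticGerm.FlatAfterBaseChange φ F (Ideal.Quotient.mkₐ 𝕜 I) ∧
      ∀ (OT : Type u) [CommRing OT] [Algebra 𝕜 OT],
        AnalyticGerm.IsLocalAnalyticAlgebra 𝕜 OT →
        ∀ lam : OW →ₐ[𝕜] OT, AnalyticGerm.FlatAfterBaseChange φ F lam →
          ∃! μ : (OW ⧸ I) →ₐ[𝕜] OT, μ.comp (Ideal.Quotient.mkₐ 𝕜 I) = lam := by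
  have := hW.isLocalRing
  let : Module OW F := Module.compHom F φ.toRingHom
  have hφ : ∀ (w : OW) (x : F), w • x = φ w • x := fun _ _ => rfl
  obtain ⟨B, v, I, h⟩ := AnalyticGerm.exists_isFlatteningFamily hW hZ φ F hφ
  have := Ideal.Quotient.nontrivial_iff.2 (ne_top_of_le_ne_top
    (IsLocalRing.maximalIdeal.isMaximal OW).ne_top
    (h.le_maximalIdeal hW.exists_sub_algebraMap_mem))
  have hP : AnalyticGerm.IsLocalAnalyticAlgebra 𝕜 (OW ⧸ I) :=
    hW.of_surjective (Ideal.Quotient.mkₐ 𝕜 I) Ideal.Quotient.mk_surjective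
  have hflat := h.flatAfterBaseChange hW hZ φ hφ
  refine ⟨I, ⟨hP, hflat, fun OT _ _ hT lam hlam => ?_⟩, ?_⟩
  · refine ⟨Ideal.Quotient.liftₐ I lam fun a ha =>
      h.map_eq_zero_of_flatAfterBaseChange hW hZ φ hφ hT lam hlam ha, ?_, ?_⟩
    · ext x
      rfl
    · rintro μ rfl
      refine Ideal.Quotient.algHom_ext _ ?_
      ext x
      rfl
  -- Each inclusion is one universal property applied to the other subgerm: that of `J` to `OW ⧸ I`,
  -- and the vanishing on `I` for the flat base change to `OW ⧸ J`.
  · rintro J ⟨hJ, hJflat, hJuniv⟩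
    refine le_antisymm (fun a ha => ?_) fun a ha => ?_
    · obtain ⟨μ, hμ, -⟩ := hJuniv (OW ⧸ I) hP _ hflat
      have h1 := DFunLike.congr_fun hμ a
      change μ (Ideal.Quotient.mk J a) = Ideal.Quotient.mk I a at h1
      rw [Ideal.Quotient.eq_zero_iff_mem.2 ha, map_zero] at h1
      exact Ideal.Quotient.eq_zero_iff_mem.1 h1.symm
    · exact Ideal.Quotient.eq_zero_iff_mem.1
        (h.map_eq_zero_of_flatAfterBaseChange hW hZ φ hφ hJ _ hJflat ha)
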